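/- Let $\mathbb{O}$ be the octonions with standard basis $e_0=1,e_1,\dots,e_7$, conjugation $p\mapsto\bar p$ and $|p|=\sqrt{p\bar p}$. A right $\mathbb{O}$-module is a real vector space $M$ with a unital real-bilinear right action of $\mathbb{O}$ such that $[x,p,q]:=(xp)q-x(pq)=-[x,q,p]$. An $\mathbb{O}$-bimodule is a right $\mathbb{O}$-module with in addition a unital real-bilinear left action such that $[p,q,x]=[q,x,p]=[x,p,q]=-[q,p,x]$ for all $p,q\in\mathbb{O}$, $x\in M$ (where $[a,b,c]=(ab)c-a(bc)$). Its real part is $\operatorname{Re}M=\{m\in M:[p,q,m]=0\ \forall p,q\in\mathbb{O}\}$, and the real part operator on $M$ is $\operatorname{Re}m=\frac5{12}m-\frac1{12}\sum_{i=1}^7e_ime_i$. A real-linear map $f:M\to M'$ between $\mathbb{O}$-bimodules is right para-linear if $\operatorname{Re}B_p(f,x)=0$ for all $p,x$, where $B_p(f,x):=f(x)p-f(xp)$, and left para-linear if $\operatorname{Re}\big(f(px)-pf(x)\big)=0$ for all $p,x$. A Hilbert $\mathbb{O}$-bimodule is an $\mathbb{O}$-bimodule $H$ with a real-bilinear map $\langle\cdot,\cdot\rangle:H\times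 H\to\mathbb{O}$ such that each $\langle u,\cdot\rangle$ is right para-linear, $\langle u,v\rangle=\overline{\langle v,u\rangle}$, $\langle u,u\rangle$ is a non-negative real, zero only for $u=0$, and $H$ is complete for $\|u\|=\sqrt{\langle u,u\rangle}$. For Hilbert $\mathbb{O}$-bimodules $H_1,H_2$ let $\mathscr{B}_{\mathcal{RO}}(H_1,H_2)$ be the space of bounded right para-linear maps $H_1\to H_2$ with the operator norm, and $\mathscr{B}_{\mathcal{RO}}(H)=\mathscr{B}_{\mathcal{RO}}(H,H)$. For $r\in\mathbb{O}$ and $T\in\mathscr{B}_{\mathcal{RO}}(H_1,H_2)$ put $$(r\odot T)(x)=r\,T(x)+B_r(T,x),\qquad (T\odot r)(x)=T(rx)-B_r(T,x).$$ For $S,T\in\mathscr{B}_{\mathcal{RO}}(H)$ the regular composition $S\circledcirc T$ is the unique right para-linear map $H\to H$ with $\operatorname{Re}\big((S\circledcirc T)(x)\big)=\operatorname{Re}\big(S(T(x))\big)$ for all $x\in H$. A Banach $\mathbb{O}$-bimodule is an $\mathbb{O}$-bimodule with a complete real norm $N$ such that $N(rx)=|r|N(x)=N(xr)$ for all $r\in\mathbb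 O$. An $\mathbb{O}$-algebra is an $\mathbb{O}$-bimodule $\mathcal{U}$ with a real-bilinear multiplication such that every left multiplication operator $y\mapsto xy$ is right para-linear and every right multiplication operator $x\mapsto xy$ is left para-linear, together with an element $e\in\operatorname{Re}\mathcal{U}$, the unit, such that $(pe)x=px$ and $x(pe)=xp$ for all $x\in\mathcal{U}$, $p\in\mathbb{O}$. An octonionic Banach algebra is an $\mathbb{O}$-algebra with a norm $N$ for which it is a Banach $\mathbb{O}$-bimodule and $N(xy)\le N(x)N(y)$. **Theorem.** 1. For all Hilbert $\mathbb{O}$-bimodules $H_1,H_2$, the space $\mathscr{B}_{\mathcal{RO}}(H_1,H_2)$ with the actions $\odot$ and the operator norm is a Banach $\mathbb{O}$-bimodule; in particular $r\odot T$ and $T\odot r$ belong to it and $\|r\odot T\|=|r|\,\|T\|=\|T\odot r\|$. 2. For every Hilbert $\mathbb{O}$-bimodule $H$ and all $S,T\in\mathscr{B}_{\mathcal{RO}}(H)$, the regular composition $S\circledcirc T$ exists, is unique, and lies in $\mathscr{B}_{\mathcal{RO}}(H)$; and $\mathscr{B}_{\mathcal{RO}}(H)$ with the actions $\odot$ and the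 multiplication $\circledcirc$ is an $\mathbb{O}$-algebra whose unit is the identity operator. 3. $\|S\circledcirc T\|\le 8\,\|S\|\,\|T\|$ for all $S,T\in\mathscr{B}_{\mathcal{RO}}(H)$, and under the norm $\|T\|':=8\|T\|$ the $\mathbb{O}$-algebra $\mathscr{B}_{\mathcal{RO}}(H)$ is an octonionic Banach algebra. -/

import Mathlib

open Filter Topology

namespace OctonionicOp

/-- The octonions: `⟨c0, …, c7⟩` stands for `c0 * e 0 + c1 * e 1 + ⋯ + c7 * e 7`, `e 0 = 1`. -/
@[ext]
structure Octonion where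
  (c0 c1 c2 c3 c4 c5 c6 c7 : ℝ)

namespace Octonion

noncomputable section

instance : Zero Octonion := ⟨⟨0, 0, 0, 0, 0, 0, 0, 0⟩⟩
instance : One Octonion := ⟨⟨1, 0, 0, 0, 0, 0, 0, 0⟩⟩
instance : Add Octonion := ⟨fun x y => ⟨x.c0 + y.c0, x.c1 + y.c1, x.c2 + y.c2, x.c3 + y.c3,
  x.c4 + y.c4, x.c5 + y.c5, x.c6 + y.c6, x.c7 + y.c7⟩⟩
instance : Neg Octonion := ⟨fun x => ⟨-x.c0, -x.c1, -x.c2, -x.c3, -x.c4, -x.c5, -x.c6, -x.c7⟩⟩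
instance : SMul ℝ Octonion := ⟨fun r x => ⟨r * x.c0, r * x.c1, r * x.c2, r * x.c3,
  r * x.c4, r * x.c5, r * x.c6, r * x.c7⟩⟩

/-- The octonion product: `e 0` is the unit, `e i * e i = -1` for `i ≥ 1`, and `e i * e j = e k`,
`e j * e i = -e k` for `(i, j, k)` a cyclic permutation of one of the oriented triples
(123), (145), (176), (246), (257), (347), (365). -/
instance : Mul Octonion := ⟨fun x y =>
  ⟨x.c0 * y.c0 - x.c1 * y.c1 - x.c2 * y.c2 - x.c3 * y.c3
      - x.c4 * y.c4 - x.c5 * y.c5 - x.c6 * y.c6 - x.c7 * y.c7,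
    x.c0 * y.c1 + x.c1 * y.c0 + (x.c2 * y.c3 - x.c3 * y.c2) + (x.c4 * y.c5 - x.c5 * y.c4)
      + (x.c7 * y.c6 - x.c6 * y.c7),
    x.c0 * y.c2 + x.c2 * y.c0 + (x.c3 * y.c1 - x.c1 * y.c3) + (x.c4 * y.c6 - x.c6 * y.c4)
      + (x.c5 * y.c7 - x.c7 * y.c5),
    x.c0 * y.c3 + x.c3 * y.c0 + (x.c1 * y.c2 - x.c2 * y.c1) + (x.c4 * y.c7 - x.c7 * y.c4)
      + (x.c6 * y.c5 - x.c5 * y.c6),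
    x.c0 * y.c4 + x.c4 * y.c0 + (x.c5 * y.c1 - x.c1 * y.c5) + (x.c6 * y.c2 - x.c2 * y.c6)
      + (x.c7 * y.c3 - x.c3 * y.c7),
    x.c0 * y.c5 + x.c5 * y.c0 + (x.c1 * y.c4 - x.c4 * y.c1) + (x.c7 * y.c2 - x.c2 * y.c7)
      + (x.c3 * y.c6 - x.c6 * y.c3),
    x.c0 * y.c6 + x.c6 * y.c0 + (x.c1 * y.c7 - x.c7 * y.c1) + (x.c2 * y.c4 - x.c4 * y.c2)
      + (x.c5 * y.c3 - x.c3 * y.c5),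
    x.c0 * y.c7 + x.c7 * y.c0 + (x.c6 * y.c1 - x.c1 * y.c6) + (x.c2 * y.c5 - x.c5 * y.c2)
      + (x.c3 * y.c4 - x.c4 * y.c3)⟩⟩

theorem zero_def : (0 : Octonion) = ⟨0, 0, 0, 0, 0, 0, 0, 0⟩ := rfl
theorem one_def : (1 : Octonion) = ⟨1, 0, 0, 0, 0, 0, 0, 0⟩ := rfl
theorem add_def (x y : Octonion) : x + y = ⟨x.c0 + y.c0, x.c1 + y.c1, x.c2 + y.c2,
  x.c3 + y.c3, x.c4 + y.c4, x.c5 + y.c5, x.c6 + y.c6, x.c7 + y.c7⟩ := rfl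
theorem neg_def (x : Octonion) :
  -x = ⟨-x.c0, -x.c1, -x.c2, -x.c3, -x.c4, -x.c5, -x.c6, -x.c7⟩ := rfl
theorem smul_def (r : ℝ) (x : Octonion) : r • x = ⟨r * x.c0, r * x.c1, r * x.c2,
  r * x.c3, r * x.c4, r * x.c5, r * x.c6, r * x.c7⟩ := rfl
theorem mul_def (x y : Octonion) : x * y =
  ⟨x.c0 * y.c0 - x.c1 * y.c1 - x.c2 * y.c2 - x.c3 * y.c3
      - x.c4 * y.c4 - x.c5 * y.c5 - x.c6 * y.c6 - x.c7 * y.c7,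
    x.c0 * y.c1 + x.c1 * y.c0 + (x.c2 * y.c3 - x.c3 * y.c2) + (x.c4 * y.c5 - x.c5 * y.c4)
      + (x.c7 * y.c6 - x.c6 * y.c7),
    x.c0 * y.c2 + x.c2 * y.c0 + (x.c3 * y.c1 - x.c1 * y.c3) + (x.c4 * y.c6 - x.c6 * y.c4)
      + (x.c5 * y.c7 - x.c7 * y.c5),
    x.c0 * y.c3 + x.c3 * y.c0 + (x.c1 * y.c2 - x.c2 * y.c1) + (x.c4 * y.c7 - x.c7 * y.c4)
      + (x.c6 * y.c5 - x.c5 * y.c6),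
    x.c0 * y.c4 + x.c4 * y.c0 + (x.c5 * y.c1 - x.c1 * y.c5) + (x.c6 * y.c2 - x.c2 * y.c6)
      + (x.c7 * y.c3 - x.c3 * y.c7),
    x.c0 * y.c5 + x.c5 * y.c0 + (x.c1 * y.c4 - x.c4 * y.c1) + (x.c7 * y.c2 - x.c2 * y.c7)
      + (x.c3 * y.c6 - x.c6 * y.c3),
    x.c0 * y.c6 + x.c6 * y.c0 + (x.c1 * y.c7 - x.c7 * y.c1) + (x.c2 * y.c4 - x.c4 * y.c2)
      + (x.c5 * y.c3 - x.c3 * y.c5),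
    x.c0 * y.c7 + x.c7 * y.c0 + (x.c6 * y.c1 - x.c1 * y.c6) + (x.c2 * y.c5 - x.c5 * y.c2)
      + (x.c3 * y.c4 - x.c4 * y.c3)⟩ := rfl

attribute [local simp] zero_def one_def add_def neg_def smul_def mul_def

instance : AddCommGroup Octonion where
  add_assoc x y z := by ext <;> simp only [add_def] <;> ring
  zero_add x := by ext <;> simp
  add_zero x := by ext <;> simp
  add_comm x y := by ext <;> simp only [add_def] <;> ring
  neg_add_cancel x := by ext <;> simp
  nsmul := nsmulRec
  zsmul := zsmulRec

theorem sub_def (x y : Octonion) : x - y = ⟨x.c0 - y.c0, x.c1 - y.c1, x.c2 - y.c2,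
    x.c3 - y.c3, x.c4 - y.c4, x.c5 - y.c5, x.c6 - y.c6, x.c7 - y.c7⟩ := by
  rw [sub_eq_add_neg]; ext <;> simp <;> ring

instance : Module ℝ Octonion where
  one_smul x := by ext <;> simp
  mul_smul r s x := by ext <;> simp <;> ring
  smul_zero r := by ext <;> simp
  smul_add r x y := by ext <;> simp <;> ring
  add_smul r s x := by ext <;> simp <;> ring
  zero_smul x := by ext <;> simp

/-- The standard basis. -/
def e : Fin 8 → Octonion :=
  ![⟨1, 0, 0, 0, 0, 0, 0, 0⟩, ⟨0, 1, 0, 0, 0, 0, 0, 0⟩, ⟨0, 0, 1, 0, 0, 0, 0, 0⟩,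
    ⟨0, 0, 0, 1, 0, 0, 0, 0⟩, ⟨0, 0, 0, 0, 1, 0, 0, 0⟩, ⟨0, 0, 0, 0, 0, 1, 0, 0⟩,
    ⟨0, 0, 0, 0, 0, 0, 1, 0⟩, ⟨0, 0, 0, 0, 0, 0, 0, 1⟩]

/-- The embedding of the reals. -/
def ofReal (r : ℝ) : Octonion := ⟨r, 0, 0, 0, 0, 0, 0, 0⟩

/-- Conjugation. -/
def conj (x : Octonion) : Octonion :=
  ⟨x.c0, -x.c1, -x.c2, -x.c3, -x.c4, -x.c5, -x.c6, -x.c7⟩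

/-- `|x| = √(x x̄)`; the octonion `x x̄` is real. -/
instance : Norm Octonion := ⟨fun x => √(x * conj x).c0⟩

/-- The product as a real bilinear map. -/
def mulL : Octonion →ₗ[ℝ] Octonion →ₗ[ℝ] Octonion :=
  LinearMap.mk₂ ℝ (fun x y => x * y)
    (fun x y z => by ext <;> simp only [mul_def, add_def] <;> ring)
    (fun r x y => by ext <;> simp only [mul_def, smul_def] <;> ring)
    (fun x y z => by ext <;> simp only [mul_def, add_def] <;> ring)
    (fun r x y => by ext <;> simp only [mul_def, smul_def] <;> ring)

theorem mul_one' (x : Octonion) : x * 1 = x := by ext <;> simp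
theorem one_mul' (x : Octonion) : 1 * x = x := by ext <;> simp

theorem assoc_right (x p q : Octonion) :
    (x * p) * q - x * (p * q) = -((x * q) * p - x * (q * p)) := by
  ext <;> simp only [mul_def, sub_def, neg_def] <;> ring

theorem assoc_left (p q x : Octonion) :
    (p * q) * x - p * (q * x) = -((q * p) * x - q * (p * x)) := by
  ext <;> simp only [mul_def, sub_def, neg_def] <;> ring

theorem assoc_cycle (p q x : Octonion) :
    (p * q) * x - p * (q * x) = (q * x) * p - q * (x * p) := by
  ext <;> simp only [mul_def, sub_def] <;> ring

end

end Octonion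

/-! ### Octonionic modules -/

/-- A right `𝕆`-module: a real vector space with a unital real bilinear right action of the
octonions (`rsmul p x` is `x p`), such that `[x, p, q] = (x p) q - x (p q)` is alternating. -/
class RightOModule (M : Type*) [AddCommGroup M] [Module ℝ M] where
  rsmul : Octonion →ₗ[ℝ] M →ₗ[ℝ] M
  rsmul_one : ∀ x, rsmul 1 x = x
  rassoc_swap : ∀ (x : M) (p q : Octonion),
    rsmul q (rsmul p x) - rsmul (p * q) x = -(rsmul p (rsmul q x) - rsmul (q * p) x)

/-- An `𝕆`-bimodule: a right `𝕆`-module with a unital real bilinear left action (`lsmul p x` is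
`p x`), such that `[p, q, x] = [q, x, p] = [x, p, q] = -[q, p, x]`. -/
class OBimodule (M : Type*) [AddCommGroup M] [Module ℝ M] extends RightOModule M where
  lsmul : Octonion →ₗ[ℝ] M →ₗ[ℝ] M
  lsmul_one : ∀ x, lsmul 1 x = x
  lassoc_eq_massoc : ∀ (p q : Octonion) (x : M),
    lsmul (p * q) x - lsmul p (lsmul q x) = rsmul p (lsmul q x) - lsmul q (rsmul p x)
  massoc_eq_rassoc : ∀ (p q : Octonion) (x : M),
    rsmul p (lsmul q x) - lsmul q (rsmul p x) = rsmul q (rsmul p x) - rsmul (p * q) x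
  rassoc_eq_neg_lassoc : ∀ (p q : Octonion) (x : M),
    rsmul q (rsmul p x) - rsmul (p * q) x = -(lsmul (q * p) x - lsmul q (lsmul p x))

/-- `p ◃ x` is the left scalar multiple `p x`. -/
scoped notation:73 scal:74 " ◃ " vect:73 => OBimodule.lsmul scal vect
/-- `x ▹ p` is the right scalar multiple `x p`. -/
scoped notation:73 vect:73 " ▹ " scal:74 => RightOModule.rsmul scal vect

/-- The regular bimodule: the octonions acting on themselves by multiplication. -/
noncomputable instance : OBimodule Octonion where
  rsmul := Octonion.mulL.flip
  rsmul_one x := Octonion.mul_one' x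
  rassoc_swap x p q := (Octonion.assoc_right x p q)
  lsmul := Octonion.mulL
  lsmul_one x := Octonion.one_mul' x
  lassoc_eq_massoc p q x := Octonion.assoc_cycle p q x
  massoc_eq_rassoc p q x := Octonion.assoc_cycle q x p
  rassoc_eq_neg_lassoc p q x := (Octonion.assoc_cycle x p q).trans (Octonion.assoc_left p q x)

section Bimodules

variable {M M' M'' : Type*} [AddCommGroup M] [Module ℝ M] [AddCommGroup M'] [Module ℝ M']
  [AddCommGroup M''] [Module ℝ M'']

/-- The real part `Re M` of a bimodule, `{m | [p, q, m] = 0 for all p, q}`. -/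
def realPart (M : Type*) [AddCommGroup M] [Module ℝ M] [OBimodule M] : Set M :=
  {m | ∀ p q : Octonion, (p * q) ◃ m - p ◃ (q ◃ m) = 0}

/-- The real part operator `Re m = (5/12) m - (1/12) ∑_{i=1}^7 e_i m e_i`. -/
noncomputable def Re [OBimodule M] (m : M) : M :=
  (5 / 12 : ℝ) • m - (1 / 12 : ℝ) • ∑ i : Fin 7, (Octonion.e i.succ ◃ m) ▹ Octonion.e i.succ

/-- The second right associator `B_p(f, x) = f(x) p - f(x p)`. -/
def B [RightOModule M] [RightOModule M'] (p : Octonion) (f : M → M') (x : M) : M' :=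
  f x ▹ p - f (x ▹ p)

/-- Right para-linearity of a real linear map. -/
def IsRightParaLinear [RightOModule M] [OBimodule M'] (f : M →ₗ[ℝ] M') : Prop :=
  ∀ (p : Octonion) (x : M), Re (B p f x) = 0

/-- Left para-linearity of a real linear map. -/
def IsLeftParaLinear [OBimodule M] [OBimodule M'] (f : M →ₗ[ℝ] M') : Prop :=
  ∀ (p : Octonion) (x : M), Re (f (p ◃ x) - p ◃ f x) = 0

/-- `h` is a regular composition of `f` and `g`: a para-linear map with
`Re (h x) = Re (f (g x))` for all `x`. -/
def IsRegularComp [RightOModule M] [OBimodule M''] (f : M' →ₗ[ℝ] M'') (g : M →ₗ[ℝ] M')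
    (h : M →ₗ[ℝ] M'') : Prop :=
  IsRightParaLinear h ∧ ∀ x, Re (h x) = Re (f (g x))

end Bimodules

/-! ### Hilbert bimodules and bounded para-linear operators -/

/-- A pre-Hilbert `𝕆`-bimodule whose norm is the one of its right `𝕆`-inner product. A Hilbert
`𝕆`-bimodule is one that is complete. -/
class PreHilbertOBimodule (H : Type*) [NormedAddCommGroup H] [NormedSpace ℝ H]
    extends OBimodule H where
  inner : H →ₗ[ℝ] H →ₗ[ℝ] Octonion
  inner_paraLinear : ∀ u, IsRightParaLinear (inner u)
  inner_hermitian : ∀ u v, inner u v = (inner v u).conj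
  inner_self_nonneg : ∀ u, ∃ r : ℝ, 0 ≤ r ∧ inner u u = Octonion.ofReal r
  inner_self_eq_zero : ∀ u, inner u u = 0 ↔ u = 0
  norm_eq_sqrt : ∀ u, ‖u‖ = √(inner u u).c0

section Operators

variable {M M' : Type*} [AddCommGroup M] [Module ℝ M] [AddCommGroup M'] [Module ℝ M']

theorem Re_zero [OBimodule M] : Re (0 : M) = 0 := by simp [Re]

theorem Re_add [OBimodule M] (x y : M) : Re (x + y) = Re x + Re y := by
  simp only [Re, map_add, Finset.sum_add_distrib, smul_add]; abel

theorem Re_smul [OBimodule M] (c : ℝ) (x : M) : Re (c • x) = c • Re x := by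
  simp only [Re, map_smul, smul_sub, ← Finset.smul_sum, smul_comm _ c]

variable (H₁ H₂ : Type*) [NormedAddCommGroup H₁] [NormedSpace ℝ H₁] [PreHilbertOBimodule H₁]
  [NormedAddCommGroup H₂] [NormedSpace ℝ H₂] [PreHilbertOBimodule H₂]

/-- The real normed space of bounded right para-linear operators `H₁ → H₂`, with the operator
norm. -/
def BRO : Submodule ℝ (H₁ →L[ℝ] H₂) where
  carrier := {T | IsRightParaLinear (T : H₁ →ₗ[ℝ] H₂)}
  zero_mem' p x := by simp [B, Re_zero]
  add_mem' {S T} hS hT p x := by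
    have : B p (fun y => S y + T y) x = B p S x + B p T x := by
      simp only [B, map_add]; abel
    have h := Re_add (B p S x) (B p T x)
    rw [← this] at h
    exact h.trans (by rw [show Re (B p S x) = 0 from hS p x, show Re (B p T x) = 0 from hT p x,
      add_zero])
  smul_mem' c T hT p x := by
    have : B p (fun y => c • T y) x = c • B p T x := by
      simp only [B, map_smul, smul_sub]
    have h := Re_smul c (B p T x)
    rw [← this] at h
    exact h.trans (by rw [show Re (B p T x) = 0 from hT p x, smul_zero])

end Operators

/-! ### Octonionic algebras and Banach structures -/

/-- An `𝕆`-algebra: an `𝕆`-bimodule with a para-bilinear multiplication (each `y ↦ x y` is right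
para-linear, each `x ↦ x y` is left para-linear) and a unit `e` in the real part such that
`(p e) x = p x` and `x (p e) = x p`. -/
class OAlgebra (U : Type*) [AddCommGroup U] [Module ℝ U] extends OBimodule U where
  mul : U →ₗ[ℝ] U →ₗ[ℝ] U
  mul_left_paraLinear : ∀ x, IsRightParaLinear (mul x)
  mul_right_paraLinear : ∀ y, IsLeftParaLinear (mul.flip y)
  unit : U
  unit_mem : unit ∈ realPart U
  unit_mul : ∀ (p : Octonion) (x : U), mul (p ◃ unit) x = p ◃ x
  mul_unit : ∀ (p : Octonion) (x : U), mul x (p ◃ unit) = x ▹ p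

/-- The bimodule `U` is a Banach `𝕆`-bimodule under the function `N`: `N` is a real norm, `U` is
complete for it, and `N (p x) = |p| N x = N (x p)`. -/
structure IsBanachOBimodule {U : Type*} [AddCommGroup U] [Module ℝ U] (_ : OBimodule U)
    (N : U → ℝ) : Prop where
  nonneg : ∀ x, 0 ≤ N x
  eq_zero_iff : ∀ x, N x = 0 ↔ x = 0
  add_le : ∀ x y, N (x + y) ≤ N x + N y
  real_smul : ∀ (c : ℝ) x, N (c • x) = |c| * N x
  complete : ∀ u : ℕ → U, (∀ ε > 0, ∃ n₀, ∀ m ≥ n₀, ∀ n ≥ n₀, N (u m - u n) < ε) →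
    ∃ x, Tendsto (fun n => N (u n - x)) atTop (𝓝 0)
  lsmul : ∀ (p : Octonion) x, N (p ◃ x) = ‖p‖ * N x
  rsmul : ∀ (p : Octonion) x, N (x ▹ p) = ‖p‖ * N x

/-- The `𝕆`-algebra `U` is an octonionic Banach algebra under the function `N`: it is a Banach
`𝕆`-bimodule and `N` is submultiplicative. -/
structure IsOctonionicBanachAlgebra {U : Type*} [AddCommGroup U] [Module ℝ U] (A : OAlgebra U)
    (N : U → ℝ) : Prop where
  banach : IsBanachOBimodule A.toOBimodule N
  mul_le : ∀ x y, N (A.mul x y) ≤ N x * N y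

/-- The left and right actions of a bimodule structure on `BRO H₁ H₂` are
`(r ⊙ T) x = r (T x) + B_r(T, x)` and `(T ⊙ r) x = T (r x) - B_r(T, x)`. -/
def IsOperatorAction {H₁ H₂ : Type*} [NormedAddCommGroup H₁] [NormedSpace ℝ H₁]
    [PreHilbertOBimodule H₁] [NormedAddCommGroup H₂] [NormedSpace ℝ H₂] [PreHilbertOBimodule H₂]
    (S : OBimodule (BRO H₁ H₂)) : Prop :=
  ∀ (r : Octonion) (T : BRO H₁ H₂) (x : H₁),
    (S.lsmul r T).1 x = r ◃ T.1 x + B r T.1 x ∧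
    (S.rsmul r T).1 x = T.1 (r ◃ x) - B r T.1 x

end OctonionicOp

/-! Every bimodule `M` looks like `𝕆 ⊗ Re M`. The left multiplications by `e 1, …, e 7` satisfy the
Clifford relations, and each right multiplication by a unit is a polynomial in them
(`two_smul_rsmul`). That right multiplication also squares to `-1`, which forces the product of the
four units off a line of the Fano plane to be, up to sign, the product of the three units on it
(`mul_eq_mul_of_commute`, `quad_relations`). Hence the operator `Re` is a signed average over the
seven lines whose range lies in `realPart M`, and `x` is recovered from `Re x` and the `Re (e_i x)`
(`sum_reProj`). An identity linear in `x` then only has to be checked on `q m` with `m` real, that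
is, on octonions (`eq_of_real`).

Since `x = ∑ e_i Re (x ē_i)`, a para-linear map is determined by its real part, and any real-linear
map has the same real part as a unique para-linear one (`paraExtend`). This gives the regular
composition; its formula has eight terms, each of norm at most `‖S‖ ‖T‖ ‖x‖`, whence the factor 8.

On real parts the two actions on operators become multiplications of the argument: `Re ((r ⊙ T) x) =
Re (T (x r))` and `Re ((T ⊙ r) x) = Re (T (r x))`. So the axioms for operators follow from those of
the source. For the norm, Moufang identities give `|r|² (r ⊙ T) x = (r T(x r̄)) r` and `|r|² (T ⊙ r)
x = T(r x r) r̄`. Multiplications by `r` scale the Hilbert norm by `|r|`, so both actions have norm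
at most `|r| ‖T‖`; acting by `r̄` afterwards gives equality. -/

namespace OctonionicOp

/-! ### Associator identities and commuting square roots of -1 -/

section Structure

variable {M : Type*} [AddCommGroup M] [Module ℝ M] [OBimodule M]

theorem associator_swap (p q : Octonion) (x : M) :
    (p * q) ◃ x - p ◃ (q ◃ x) = -((q * p) ◃ x - q ◃ (p ◃ x)) :=
  (OBimodule.lassoc_eq_massoc p q x).trans ((OBimodule.massoc_eq_rassoc p q x).trans
    (OBimodule.rassoc_eq_neg_lassoc p q x))

theorem lsmul_lsmul_self (p : Octonion) (x : M) : p ◃ (p ◃ x) = (p * p) ◃ x := by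
  have h := associator_swap p p x
  linear_combination (norm := module) (-1 / 2 : ℝ) • h

theorem rsmul_rsmul_self (p : Octonion) (x : M) : (x ▹ p) ▹ p = x ▹ (p * p) := by
  have h := RightOModule.rassoc_swap x p p
  linear_combination (norm := module) (1 / 2 : ℝ) • h

/-- The commutator of an associator with a module element is a sum of associators. -/
theorem associator_commutator (w x y : Octonion) (m : M) :
    ((w * x) * y) ◃ m - (w * (x * y)) ◃ m - (m ▹ ((w * x) * y) - m ▹ (w * (x * y))) =
      (1 / 2 : ℝ) • (((w * x) * y) ◃ m - (w * x) ◃ (y ◃ m)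
          - (((x * w) * y) ◃ m - (x * w) ◃ (y ◃ m))
        + (((x * y) * w) ◃ m - (x * y) ◃ (w ◃ m) - (((y * x) * w) ◃ m - (y * x) ◃ (w ◃ m)))
        + (((y * w) * x) ◃ m - (y * w) ◃ (x ◃ m)
          - (((w * y) * x) ◃ m - (w * y) ◃ (x ◃ m)))) := by
  have h0 := OBimodule.lassoc_eq_massoc (w * x) y m
  have h1 := congrArg (fun u => u ◃ m) (Octonion.assoc_left w x y)
  have h2 := OBimodule.rassoc_eq_neg_lassoc x (w * y) m
  have h3 := OBimodule.lassoc_eq_massoc x (w * y) m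
  have h4 := OBimodule.massoc_eq_rassoc x (w * y) m
  have h5 := OBimodule.rassoc_eq_neg_lassoc w x (y ◃ m)
  have h6 := congrArg (OBimodule.lsmul x) (OBimodule.lassoc_eq_massoc w y m)
  have h7 := congrArg (fun u => u ◃ m) (Octonion.assoc_left y w x)
  have h8 := congrArg (fun u => u ◃ m) (Octonion.assoc_right w y x)
  have h9 := OBimodule.rassoc_eq_neg_lassoc w (x * y) m
  have h10 := congrArg (OBimodule.lsmul x) (OBimodule.massoc_eq_rassoc w y m)
  have h11 := OBimodule.massoc_eq_rassoc (w * y) x m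
  have h12 := OBimodule.massoc_eq_rassoc y x (m ▹ w)
  have h13 := congrArg (RightOModule.rsmul y) (OBimodule.massoc_eq_rassoc w x m)
  have h14 := OBimodule.rassoc_eq_neg_lassoc w y (x ◃ m)
  have h15 := congrArg (OBimodule.lsmul y) (OBimodule.lassoc_eq_massoc w x m)
  have h16 := congrArg (OBimodule.lsmul y) (OBimodule.massoc_eq_rassoc w x m)
  have h17 := OBimodule.massoc_eq_rassoc (w * x) y m
  have h18 := OBimodule.massoc_eq_rassoc x y (m ▹ w)
  have h19 := congrArg (RightOModule.rsmul x) (OBimodule.massoc_eq_rassoc w y m)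
  have h20 := OBimodule.rassoc_eq_neg_lassoc (w * x) y m
  have h21 := OBimodule.rassoc_eq_neg_lassoc w (y * x) m
  have h22 := congrArg (fun u => m ▹ u) (Octonion.assoc_right w y x)
  simp only [map_sub, map_neg, LinearMap.sub_apply, LinearMap.neg_apply] at *
  -- With the actions and the product made opaque, all words in them are atoms, and the identity is
  -- a linear combination of instances of the axioms.
  obtain ⟨l, hl⟩ : ∃ l : Octonion → M → M, ∀ p x, p ◃ x = l p x := ⟨_, fun _ _ => rfl⟩
  obtain ⟨r, hr⟩ : ∃ r : Octonion → M → M, ∀ p x, x ▹ p = r p x := ⟨_, fun _ _ => rfl⟩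
  obtain ⟨μ, hμ⟩ : ∃ μ : Octonion → Octonion → Octonion, ∀ p q, p * q = μ p q :=
    ⟨_, fun _ _ => rfl⟩
  simp only [hl, hr, hμ] at *
  linear_combination (norm := module) (-1/2 : ℝ) • h0 + (1/2 : ℝ) • h1 + (1/2 : ℝ) • h2 +
    (1/2 : ℝ) • h3 + (1/2 : ℝ) • h4 + (-1/2 : ℝ) • h5 + (1/2 : ℝ) • h6 + (-1/2 : ℝ) • h7 +
    (1/2 : ℝ) • h8 + (-1/2 : ℝ) • h9 + (1/2 : ℝ) • h10 + (1/2 : ℝ) • h11 + (-1/2 : ℝ) • h12 +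
    (-1/2 : ℝ) • h13 + (1/2 : ℝ) • h14 + (-1/2 : ℝ) • h15 + (-1/2 : ℝ) • h16 +
    (-1 : ℝ) • h17 + (1/2 : ℝ) • h18 + (1/2 : ℝ) • h19 + (-1/2 : ℝ) • h20 + (1/2 : ℝ) • h21 +
    (-1/2 : ℝ) • h22

/-- Commuting square roots `X, Y, Z, K, R` of `-1` with `2R = X + Y + Z - K` satisfy `XY = ZK`. -/
theorem mul_eq_mul_of_commute {A : Type*} [Ring A] [Algebra ℝ A] {X Y Z K R : A}
    (hX : X * X = -1) (hY : Y * Y = -1) (hZ : Z * Z = -1) (hK : K * K = -1) (hR : R * R = -1)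
    (hXY : Y * X = X * Y) (hXZ : Z * X = X * Z) (hYZ : Z * Y = Y * Z)
    (hXK : K * X = X * K) (hYK : K * Y = Y * K) (hZK : K * Z = Z * K)
    (h : (2 : ℝ) • R = X + Y + Z - K) : X * Y = Z * K := by
  have left {P Q : A} (h : P * Q = Q * P) (t : A) : P * (Q * t) = Q * (P * t) := by
    rw [← mul_assoc, h, mul_assoc]
  have sq {P : A} (h : P * P = -1) (t : A) : P * (P * t) = -t := by
    rw [← mul_assoc, h, neg_one_mul]
  -- Squaring `h`: the four squares on the right already give `-4`, so the mixed terms cancel.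
  have h4 : (X + Y + Z - K) * (X + Y + Z - K) = (2 * 2 : ℝ) • (-1) := by
    rw [← h, smul_mul_smul_comm, hR]
  simp only [mul_add, add_mul, mul_sub, sub_mul, hX, hY, hZ, hK, hXY, hXZ, hYZ, hXK, hYK,
    hZK] at h4
  have hs : X * Y + Y * Z + X * Z = X * K + Y * K + Z * K := by
    linear_combination (norm := module) (1 / 2 : ℝ) • h4
  have h1 := congrArg (X * ·) hs
  have h2 := congrArg (Y * ·) hs
  have h3 := congrArg (Z * ·) hs
  have h5 := congrArg (K * ·) hs
  simp only [mul_add, hY, hZ, hK, hYZ, hYK, hZK, left hXY, left hXZ,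
    left hYZ, left hXK, left hYK, left hZK, sq hX, sq hY, sq hZ, mul_neg, mul_one] at h1 h2 h3 h5
  -- Adding the multiples by `X`, `Y`, `Z` and using the multiple by `K` to remove the cubic terms
  -- in `K` leaves `3 X Y Z = -3 K`.
  have hP : X * (Y * Z) = -K := by
    linear_combination (norm := module) (1 / 3 : ℝ) • (h1 + h2 + h3) + (2 / 3 : ℝ) • h5
  have h6 := congrArg (Z * ·) hP
  simp only [left hXZ, left hYZ, hZ, mul_neg, mul_one] at h6
  simpa [hZK] using h6

end Structure

/-! ### Clifford relations of the left multiplications -/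

theorem Octonion.neg_mul' (p q : Octonion) : -p * q = -(p * q) := by
  ext <;> simp only [Octonion.mul_def, Octonion.neg_def] <;> ring

theorem Octonion.e_succ_mul_self (i : Fin 7) :
    Octonion.e i.succ * Octonion.e i.succ = -1 := by
  fin_cases i <;> ext <;> simp [Octonion.e, Octonion.mul_def, Octonion.neg_def, Octonion.one_def]

theorem Octonion.mul_swap {p q : Octonion} (hp : p.c0 = 0) (hq : q.c0 = 0)
    (h : p.c1 * q.c1 + p.c2 * q.c2 + p.c3 * q.c3 + p.c4 * q.c4 + p.c5 * q.c5 + p.c6 * q.c6 +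
      p.c7 * q.c7 = 0) : p * q = -(q * p) := by
  ext <;> simp only [Octonion.mul_def, Octonion.neg_def, hp, hq] <;> linarith

theorem Octonion.e_succ_mul_swap {i j : Fin 7} (h : i ≠ j) :
    Octonion.e i.succ * Octonion.e j.succ = -(Octonion.e j.succ * Octonion.e i.succ) := by
  apply Octonion.mul_swap <;> revert i j <;>
    simp [Octonion.e, Fin.forall_fin_succ]

section Structure

variable {M : Type*} [AddCommGroup M] [Module ℝ M] [OBimodule M]

theorem lsmul_lsmul_swap {p q : Octonion} (h : p * q = -(q * p)) (x : M) :
    p ◃ (q ◃ x) = -(q ◃ (p ◃ x)) := by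
  have := associator_swap p q x
  rw [h] at this
  simp only [map_neg, LinearMap.neg_apply] at this
  linear_combination (norm := module) -this

/-- If `w, x, y` generate the octonions like `e₁, e₂, e₄`, then the right multiplication by
`(w x) y` is a polynomial in left multiplications. -/
theorem two_smul_rsmul {w x y a b c k : Octonion} (ha : w * x = a) (hb : x * y = b)
    (hc : y * w = c) (ha' : x * w = -a) (hb' : y * x = -b) (hc' : w * y = -c) (hak : a * y = k)
    (hbk : b * w = k) (hck : c * x = k) (hk : w * b = -k) (m : M) :
    (2 : ℝ) • (m ▹ k) = a ◃ (y ◃ m) + b ◃ (w ◃ m) + c ◃ (x ◃ m) - k ◃ m := by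
  have h := associator_commutator w x y m
  simp only [ha, hb, hc, ha', hb', hc', hak, hbk, hck, hk, Octonion.neg_mul', map_neg,
    LinearMap.neg_apply] at h
  -- As `w (x y) = -(w x) y`, the left side of `h` is `2 (k m - m k)`; the right side is `3 k m`
  -- minus the three double products.
  linear_combination (norm := module) -h

/-- Left multiplication by the imaginary unit `e (i + 1)`. -/
noncomputable def lunit (M : Type*) [AddCommGroup M] [Module ℝ M] [OBimodule M] (i : Fin 7) :
    Module.End ℝ M := OBimodule.lsmul (Octonion.e i.succ)

/-- Right multiplication by the imaginary unit `e (i + 1)`. -/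
noncomputable def runit (M : Type*) [AddCommGroup M] [Module ℝ M] [OBimodule M] (i : Fin 7) :
    Module.End ℝ M := RightOModule.rsmul (Octonion.e i.succ)

theorem lunit_mul_self (i : Fin 7) : lunit M i * lunit M i = -1 := by
  ext x
  simp [lunit, lsmul_lsmul_self, Octonion.e_succ_mul_self, OBimodule.lsmul_one]

theorem runit_mul_self (i : Fin 7) : runit M i * runit M i = -1 := by
  ext x
  simp [runit, rsmul_rsmul_self, Octonion.e_succ_mul_self, RightOModule.rsmul_one]

theorem lunit_mul_swap {i j : Fin 7} (h : i ≠ j) :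
    lunit M i * lunit M j = -(lunit M j * lunit M i) := by
  ext x
  simp [lunit, lsmul_lsmul_swap (Octonion.e_succ_mul_swap h)]

theorem lunit_mul_of_lt {i j : Fin 7} (h : j < i) :
    lunit M i * lunit M j = -(lunit M j * lunit M i) := lunit_mul_swap h.ne'

theorem lunit_mul_mul_self (i : Fin 7) (t : Module.End ℝ M) :
    lunit M i * (lunit M i * t) = -t := by
  rw [← mul_assoc, lunit_mul_self, neg_one_mul]

theorem lunit_mul_mul_of_lt {i j : Fin 7} (h : j < i) (t : Module.End ℝ M) :
    lunit M i * (lunit M j * t) = -(lunit M j * (lunit M i * t)) := by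
  rw [← mul_assoc, lunit_mul_of_lt h, neg_mul, mul_assoc]

theorem lunit_pair_sq {i j : Fin 7} (h : i ≠ j) :
    lunit M i * lunit M j * (lunit M i * lunit M j) = -1 := by
  rw [mul_assoc, ← mul_assoc (lunit M j), lunit_mul_swap h.symm, neg_mul, mul_neg, mul_assoc,
    lunit_mul_self, ← mul_assoc, lunit_mul_self]
  simp

theorem lunit_commute_pair {i j k : Fin 7} (hi : i ≠ k) (hj : j ≠ k) :
    lunit M k * (lunit M i * lunit M j) = lunit M i * lunit M j * lunit M k := by
  rw [← mul_assoc, lunit_mul_swap hi.symm, neg_mul, mul_assoc, lunit_mul_swap hj.symm,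
    mul_neg, neg_neg, mul_assoc]

theorem lunit_pair_commute {i j k l : Fin 7} (hik : i ≠ k) (hjk : j ≠ k) (hil : i ≠ l)
    (hjl : j ≠ l) :
    lunit M k * lunit M l * (lunit M i * lunit M j) =
      lunit M i * lunit M j * (lunit M k * lunit M l) := by
  rw [mul_assoc, lunit_commute_pair hil hjl, ← mul_assoc, lunit_commute_pair hik hjk, mul_assoc]

/-- The three lines through `k` in terms of left multiplications. -/
theorem line_relations {x x' y y' z z' k : Fin 7} (hn : [x, x', y, y', z, z', k].Nodup)
    (h : (2 : ℝ) • runit M k = lunit M x * lunit M x' + lunit M y * lunit M y'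
      + lunit M z * lunit M z' - lunit M k) :
    lunit M x * lunit M x' * (lunit M y * lunit M y') = lunit M z * lunit M z' * lunit M k ∧
    lunit M y * lunit M y' * (lunit M z * lunit M z') = lunit M x * lunit M x' * lunit M k ∧
    lunit M z * lunit M z' * (lunit M x * lunit M x') = lunit M y * lunit M y' * lunit M k := by
  simp only [List.nodup_cons, List.mem_cons, not_or, List.not_mem_nil, not_false_eq_true] at hn
  obtain ⟨⟨xx, xy, xy', xz, xz', xk, -⟩, ⟨x'y, x'y', x'z, x'z', x'k, -⟩,
    ⟨yy, yz, yz', yk, -⟩, ⟨y'z, y'z', y'k, -⟩, ⟨zz, zk, -⟩, ⟨z'k, -⟩, -⟩ := hn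
  have hX := lunit_pair_sq (M := M) xx
  have hY := lunit_pair_sq (M := M) yy
  have hZ := lunit_pair_sq (M := M) zz
  have hXY := lunit_pair_commute (M := M) xy x'y xy' x'y'
  have hXZ := lunit_pair_commute (M := M) xz x'z xz' x'z'
  have hYZ := lunit_pair_commute (M := M) yz y'z yz' y'z'
  have hXK := lunit_commute_pair (M := M) xk x'k
  have hYK := lunit_commute_pair (M := M) yk y'k
  have hZK := lunit_commute_pair (M := M) zk z'k
  refine ⟨?_, ?_, ?_⟩
  · exact mul_eq_mul_of_commute hX hY hZ (lunit_mul_self k) (runit_mul_self k) hXY hXZ hYZ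
      hXK hYK hZK h
  · exact mul_eq_mul_of_commute hY hZ hX (lunit_mul_self k) (runit_mul_self k) hYZ hXY.symm
      hXZ.symm hYK hZK hXK (by rw [h]; abel)
  · exact mul_eq_mul_of_commute hZ hX hY (lunit_mul_self k) (runit_mul_self k) hXZ.symm
      hYZ.symm hXY hZK hXK hYK (by rw [h]; abel)

end Structure

/-! ### Right multiplications and the real part as polynomials in left multiplications -/

section Structure

variable {M : Type*} [AddCommGroup M] [Module ℝ M] [OBimodule M]

/-- Here and in the next six lemmas, index `i` stands for `e (i + 1)`. The three pairs are the other
points of the lines through the unit, ordered so that their octonion product is that unit; a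
negative sign in `a`, `b` or `c` is absorbed by swapping a pair. -/
theorem two_smul_runit_zero : (2 : ℝ) • runit M 0 =
    lunit M 6 * lunit M 5 + lunit M 1 * lunit M 2 + lunit M 3 * lunit M 4 - lunit M 0 := by
  ext m
  have h := two_smul_rsmul (w := Octonion.e (Fin.succ 1)) (x := Octonion.e (Fin.succ 4))
    (y := Octonion.e (Fin.succ 5))
    (a := Octonion.e (Fin.succ 6)) (b := -Octonion.e (Fin.succ 2)) (c := Octonion.e (Fin.succ 3))
    (k := Octonion.e (Fin.succ 0)) ?_ ?_ ?_ ?_ ?_ ?_ ?_ ?_ ?_ ?_ m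
  · simp only [map_neg, LinearMap.neg_apply, neg_neg,
      lsmul_lsmul_swap (Octonion.e_succ_mul_swap (show (2 : Fin 7) ≠ 1 by decide))] at h
    exact h
  all_goals simp [Octonion.e, Octonion.mul_def, Octonion.neg_def]

theorem two_smul_runit_one : (2 : ℝ) • runit M 1 =
    lunit M 4 * lunit M 6 + lunit M 2 * lunit M 0 + lunit M 3 * lunit M 5 - lunit M 1 := by
  ext m
  have h := two_smul_rsmul (w := Octonion.e (Fin.succ 0)) (x := Octonion.e (Fin.succ 3))
    (y := Octonion.e (Fin.succ 6))
    (a := Octonion.e (Fin.succ 4)) (b := Octonion.e (Fin.succ 2)) (c := -Octonion.e (Fin.succ 5))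
    (k := Octonion.e (Fin.succ 1)) ?_ ?_ ?_ ?_ ?_ ?_ ?_ ?_ ?_ ?_ m
  · simp only [map_neg, LinearMap.neg_apply, neg_neg,
      lsmul_lsmul_swap (Octonion.e_succ_mul_swap (show (5 : Fin 7) ≠ 3 by decide))] at h
    exact h
  all_goals simp [Octonion.e, Octonion.mul_def, Octonion.neg_def]

theorem two_smul_runit_two : (2 : ℝ) • runit M 2 =
    lunit M 3 * lunit M 6 + lunit M 0 * lunit M 1 + lunit M 5 * lunit M 4 - lunit M 2 := by
  ext m
  have h := two_smul_rsmul (w := Octonion.e (Fin.succ 0)) (x := Octonion.e (Fin.succ 5))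
    (y := Octonion.e (Fin.succ 3))
    (a := -Octonion.e (Fin.succ 6)) (b := -Octonion.e (Fin.succ 1)) (c := -Octonion.e (Fin.succ 4))
    (k := Octonion.e (Fin.succ 2)) ?_ ?_ ?_ ?_ ?_ ?_ ?_ ?_ ?_ ?_ m
  · simp only [map_neg, LinearMap.neg_apply, neg_neg,
      lsmul_lsmul_swap (Octonion.e_succ_mul_swap (show (6 : Fin 7) ≠ 3 by decide)),
      lsmul_lsmul_swap (Octonion.e_succ_mul_swap (show (1 : Fin 7) ≠ 0 by decide)),
      lsmul_lsmul_swap (Octonion.e_succ_mul_swap (show (4 : Fin 7) ≠ 5 by decide))] at h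
    exact h
  all_goals simp [Octonion.e, Octonion.mul_def, Octonion.neg_def]

theorem two_smul_runit_three : (2 : ℝ) • runit M 3 =
    lunit M 5 * lunit M 1 + lunit M 4 * lunit M 0 + lunit M 6 * lunit M 2 - lunit M 3 := by
  ext m
  have h := two_smul_rsmul (w := Octonion.e (Fin.succ 0)) (x := Octonion.e (Fin.succ 2))
    (y := Octonion.e (Fin.succ 5))
    (a := -Octonion.e (Fin.succ 1)) (b := Octonion.e (Fin.succ 4)) (c := Octonion.e (Fin.succ 6))
    (k := Octonion.e (Fin.succ 3)) ?_ ?_ ?_ ?_ ?_ ?_ ?_ ?_ ?_ ?_ m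
  · simp only [map_neg, LinearMap.neg_apply, neg_neg,
      lsmul_lsmul_swap (Octonion.e_succ_mul_swap (show (1 : Fin 7) ≠ 5 by decide))] at h
    exact h
  all_goals simp [Octonion.e, Octonion.mul_def, Octonion.neg_def]

theorem two_smul_runit_four : (2 : ℝ) • runit M 4 =
    lunit M 2 * lunit M 5 + lunit M 0 * lunit M 3 + lunit M 6 * lunit M 1 - lunit M 4 := by
  ext m
  have h := two_smul_rsmul (w := Octonion.e (Fin.succ 0)) (x := Octonion.e (Fin.succ 1))
    (y := Octonion.e (Fin.succ 5))
    (a := Octonion.e (Fin.succ 2)) (b := -Octonion.e (Fin.succ 3)) (c := Octonion.e (Fin.succ 6))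
    (k := Octonion.e (Fin.succ 4)) ?_ ?_ ?_ ?_ ?_ ?_ ?_ ?_ ?_ ?_ m
  · simp only [map_neg, LinearMap.neg_apply, neg_neg,
      lsmul_lsmul_swap (Octonion.e_succ_mul_swap (show (3 : Fin 7) ≠ 0 by decide))] at h
    exact h
  all_goals simp [Octonion.e, Octonion.mul_def, Octonion.neg_def]

theorem two_smul_runit_five : (2 : ℝ) • runit M 5 =
    lunit M 4 * lunit M 2 + lunit M 0 * lunit M 6 + lunit M 1 * lunit M 3 - lunit M 5 := by
  ext m
  have h := two_smul_rsmul (w := Octonion.e (Fin.succ 0)) (x := Octonion.e (Fin.succ 3))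
    (y := Octonion.e (Fin.succ 2))
    (a := Octonion.e (Fin.succ 4)) (b := -Octonion.e (Fin.succ 6)) (c := Octonion.e (Fin.succ 1))
    (k := Octonion.e (Fin.succ 5)) ?_ ?_ ?_ ?_ ?_ ?_ ?_ ?_ ?_ ?_ m
  · simp only [map_neg, LinearMap.neg_apply, neg_neg,
      lsmul_lsmul_swap (Octonion.e_succ_mul_swap (show (6 : Fin 7) ≠ 0 by decide))] at h
    exact h
  all_goals simp [Octonion.e, Octonion.mul_def, Octonion.neg_def]

theorem two_smul_runit_six : (2 : ℝ) • runit M 6 =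
    lunit M 2 * lunit M 3 + lunit M 5 * lunit M 0 + lunit M 1 * lunit M 4 - lunit M 6 := by
  ext m
  have h := two_smul_rsmul (w := Octonion.e (Fin.succ 0)) (x := Octonion.e (Fin.succ 1))
    (y := Octonion.e (Fin.succ 3))
    (a := Octonion.e (Fin.succ 2)) (b := Octonion.e (Fin.succ 5)) (c := -Octonion.e (Fin.succ 4))
    (k := Octonion.e (Fin.succ 6)) ?_ ?_ ?_ ?_ ?_ ?_ ?_ ?_ ?_ ?_ m
  · simp only [map_neg, LinearMap.neg_apply, neg_neg,
      lsmul_lsmul_swap (Octonion.e_succ_mul_swap (show (4 : Fin 7) ≠ 1 by decide))] at h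
    exact h
  all_goals simp [Octonion.e, Octonion.mul_def, Octonion.neg_def]

/-- The products of the four units off a line, for the seven lines. -/
theorem quad_relations :
    lunit M 1 * (lunit M 2 * (lunit M 5 * lunit M 6)) = -(lunit M 0 * (lunit M 3 * lunit M 4)) ∧
    lunit M 1 * (lunit M 2 * (lunit M 3 * lunit M 4)) = -(lunit M 0 * (lunit M 5 * lunit M 6)) ∧
    lunit M 3 * (lunit M 4 * (lunit M 5 * lunit M 6)) = -(lunit M 0 * (lunit M 1 * lunit M 2)) ∧
    lunit M 0 * (lunit M 2 * (lunit M 4 * lunit M 6)) = -(lunit M 1 * (lunit M 3 * lunit M 5)) ∧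
    lunit M 0 * (lunit M 2 * (lunit M 3 * lunit M 5)) = -(lunit M 1 * (lunit M 4 * lunit M 6)) ∧
    lunit M 0 * (lunit M 1 * (lunit M 3 * lunit M 6)) = -(lunit M 2 * (lunit M 4 * lunit M 5)) ∧
    lunit M 0 * (lunit M 1 * (lunit M 4 * lunit M 5)) = -(lunit M 2 * (lunit M 3 * lunit M 6)) := by
  -- Every line meets the line (123), so the lines through its three points are all seven.
  obtain ⟨h1, h2, h3⟩ := line_relations (M := M) (by decide) two_smul_runit_zero
  obtain ⟨h4, h5, h6⟩ := line_relations (M := M) (by decide) two_smul_runit_one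
  obtain ⟨h7, h8, h9⟩ := line_relations (M := M) (by decide) two_smul_runit_two
  simp [mul_assoc, lunit_mul_of_lt, lunit_mul_mul_of_lt] at *
  grind

/-- The projection to the real part as a polynomial in the left multiplications. -/
noncomputable def reProj (M : Type*) [AddCommGroup M] [Module ℝ M] [OBimodule M] :
    Module.End ℝ M :=
  (1 / 8 : ℝ) • (1 - lunit M 0 * (lunit M 1 * lunit M 2) - lunit M 0 * (lunit M 3 * lunit M 4)
    + lunit M 0 * (lunit M 5 * lunit M 6) - lunit M 1 * (lunit M 3 * lunit M 5)
    - lunit M 1 * (lunit M 4 * lunit M 6) - lunit M 2 * (lunit M 3 * lunit M 6)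
    + lunit M 2 * (lunit M 4 * lunit M 5))

theorem Re_eq_reProj (x : M) : Re x = reProj M x := by
  have key (i : Fin 7) (t : Module.End ℝ M) (h : (2 : ℝ) • runit M i = t) :
      runit M i * lunit M i = (1 / 2 : ℝ) • (t * lunit M i) := by
    rw [← h, smul_mul_assoc, smul_smul]; norm_num
  have h : (5 / 12 : ℝ) • (1 : Module.End ℝ M) -
      (1 / 12 : ℝ) • ∑ i : Fin 7, runit M i * lunit M i = reProj M := by
    -- The constant term is `5/12 - 7/24 = 1/8`; each line occurs once for each of its three points,
    -- with weight `3/24 = 1/8`.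
    simp only [Fin.sum_univ_seven, key _ _ two_smul_runit_zero, key _ _ two_smul_runit_one,
      key _ _ two_smul_runit_two, key _ _ two_smul_runit_three, key _ _ two_smul_runit_four,
      key _ _ two_smul_runit_five, key _ _ two_smul_runit_six]
    simp [add_mul, sub_mul, mul_assoc, lunit_mul_of_lt, lunit_mul_mul_of_lt, lunit_mul_self]
    rw [reProj]
    module
  rw [← h]
  simp [Re, runit, lunit]

/-- For a line `(i, j, k)` the product of its units acts on the range of `reProj` as `-1`. -/
theorem line_mul_reProj :
    lunit M 0 * (lunit M 1 * lunit M 2) * reProj M = -reProj M ∧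
    lunit M 0 * (lunit M 3 * lunit M 4) * reProj M = -reProj M ∧
    lunit M 0 * (lunit M 5 * lunit M 6) * reProj M = reProj M ∧
    lunit M 1 * (lunit M 3 * lunit M 5) * reProj M = -reProj M ∧
    lunit M 1 * (lunit M 4 * lunit M 6) * reProj M = -reProj M ∧
    lunit M 2 * (lunit M 3 * lunit M 6) * reProj M = -reProj M ∧
    lunit M 2 * (lunit M 4 * lunit M 5) * reProj M = reProj M := by
  obtain ⟨h1, h2, h3, h4, h5, h6, h7⟩ := quad_relations (M := M)
  -- Two lines meet in a point, and their product is, up to sign, the product of the four units off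
  -- the third line through it, hence that line. So a line permutes the eight terms of `reProj` up
  -- to a common sign.
  refine ⟨?_, ?_, ?_, ?_, ?_, ?_, ?_⟩ <;> rw [reProj, mul_smul_comm] <;>
    simp [mul_add, mul_sub, mul_assoc, lunit_mul_of_lt, lunit_mul_mul_of_lt, lunit_mul_self,
      lunit_mul_mul_self, h1, h2, h3, h4, h5, h6, h7] <;> module

/-- The constant term of `reProj` contributes `(1 + 7)/8`. A line product commutes with its own
three units and anticommutes with the other four, so it occurs with coefficient `1 + 3 - 4 = 0`. -/
theorem sum_reProj : reProj M - ∑ i : Fin 7, lunit M i * (reProj M * lunit M i) = 1 := by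
  simp [Fin.sum_univ_seven, reProj, mul_add, add_mul, mul_sub, sub_mul, mul_assoc,
    lunit_mul_of_lt, lunit_mul_mul_of_lt, lunit_mul_self, lunit_mul_mul_self]
  module

end Structure

/-! ### Real elements and the decomposition of a bimodule -/

theorem Octonion.eq_sum_e (p : Octonion) : p = p.c0 • 1 + p.c1 • Octonion.e (Fin.succ 0) +
    p.c2 • Octonion.e (Fin.succ 1) + p.c3 • Octonion.e (Fin.succ 2) +
    p.c4 • Octonion.e (Fin.succ 3) + p.c5 • Octonion.e (Fin.succ 4) +
    p.c6 • Octonion.e (Fin.succ 5) + p.c7 • Octonion.e (Fin.succ 6) := by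
  simp [Octonion.e, Octonion.add_def, Octonion.smul_def, Octonion.one_def]

theorem Octonion.lsmul_eq_mul (p q : Octonion) : p ◃ q = p * q := rfl

theorem Octonion.rsmul_eq_mul (p q : Octonion) : p ▹ q = p * q := rfl

theorem Octonion.Re_eq (q : Octonion) : Re q = q.c0 • (1 : Octonion) := by
  simp only [Re, Fin.sum_univ_seven, Octonion.lsmul_eq_mul, Octonion.rsmul_eq_mul]
  ext <;> simp [Octonion.e, Octonion.mul_def, Octonion.smul_def, Octonion.add_def,
    Octonion.sub_def, Octonion.one_def] <;> ring

section Structure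

variable {M : Type*} [AddCommGroup M] [Module ℝ M] [OBimodule M]

theorem lsmul_eq_sum (p : Octonion) : (OBimodule.lsmul p : Module.End ℝ M) =
    p.c0 • 1 + p.c1 • lunit M 0 + p.c2 • lunit M 1 + p.c3 • lunit M 2 + p.c4 • lunit M 3 +
      p.c5 • lunit M 4 + p.c6 • lunit M 5 + p.c7 • lunit M 6 := by
  conv_lhs => rw [Octonion.eq_sum_e p]
  have h1 : (OBimodule.lsmul 1 : Module.End ℝ M) = 1 := by ext x; simp [OBimodule.lsmul_one]
  simp only [map_add, map_smul, lunit, h1]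

theorem rsmul_eq_sum (p : Octonion) : (RightOModule.rsmul p : Module.End ℝ M) =
    p.c0 • 1 + p.c1 • runit M 0 + p.c2 • runit M 1 + p.c3 • runit M 2 + p.c4 • runit M 3 +
      p.c5 • runit M 4 + p.c6 • runit M 5 + p.c7 • runit M 6 := by
  conv_lhs => rw [Octonion.eq_sum_e p]
  have h1 : (RightOModule.rsmul 1 : Module.End ℝ M) = 1 := by
    ext x; simp [RightOModule.rsmul_one]
  simp only [map_add, map_smul, runit, h1]

/-- Cancelling units from `e_i e_j e_k = -1` yields the quaternionic multiplication table of the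
line. -/
theorem pair_mul_of_line_mul {i j k : Fin 7} (hij : i ≠ j) (hjk : j ≠ k)
    {t : Module.End ℝ M} (h : lunit M i * (lunit M j * lunit M k) * t = -t) :
    lunit M i * (lunit M j * t) = lunit M k * t ∧ lunit M j * (lunit M k * t) = lunit M i * t ∧
      lunit M k * (lunit M i * t) = lunit M j * t := by
  have h1 := congrArg (lunit M i * ·) h
  simp only [mul_assoc, lunit_mul_mul_self, mul_neg] at h h1
  have h2 := neg_injective h1
  have h3 := congrArg (lunit M j * ·) h2
  simp only [lunit_mul_mul_self] at h3
  have sw {a b : Fin 7} (hab : a ≠ b) (s : Module.End ℝ M) :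
      lunit M a * (lunit M b * s) = -(lunit M b * (lunit M a * s)) := by
    rw [← mul_assoc, lunit_mul_swap hab, neg_mul, mul_assoc]
  rw [sw hij.symm] at h3
  have h4 := congrArg (lunit M k * ·) h2
  rw [sw hjk.symm, lunit_mul_mul_self, mul_neg, neg_neg] at h4
  exact ⟨(neg_injective h3).symm, h2, h4.symm⟩

/-- The tables of the seven lines make up the whole octonion table, so left multiplication is
associative on the range of `reProj`. -/
theorem lsmul_mul_reProj (p q : Octonion) :
    (OBimodule.lsmul (p * q) : Module.End ℝ M) * reProj M =
      OBimodule.lsmul p * (OBimodule.lsmul q * reProj M) := by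
  obtain ⟨h1, h2, h3, h4, h5, h6, h7⟩ := line_mul_reProj (M := M)
  obtain ⟨a1, a2, a3⟩ := pair_mul_of_line_mul (by decide) (by decide) h1
  obtain ⟨b1, b2, b3⟩ := pair_mul_of_line_mul (by decide) (by decide) h2
  -- The oriented line is (176), hence the order 0, 6, 5.
  obtain ⟨c1, c2, c3⟩ := pair_mul_of_line_mul (i := 0) (j := 6) (k := 5) (t := reProj M)
    (by decide) (by decide)
    (by rw [lunit_mul_swap (show (6 : Fin 7) ≠ 5 by decide), mul_neg, neg_mul, h3])
  obtain ⟨d1, d2, d3⟩ := pair_mul_of_line_mul (by decide) (by decide) h4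
  obtain ⟨e1, e2, e3⟩ := pair_mul_of_line_mul (by decide) (by decide) h5
  obtain ⟨f1, f2, f3⟩ := pair_mul_of_line_mul (by decide) (by decide) h6
  obtain ⟨g1, g2, g3⟩ := pair_mul_of_line_mul (i := 2) (j := 5) (k := 4) (t := reProj M)
    (by decide) (by decide)
    (by rw [lunit_mul_swap (show (5 : Fin 7) ≠ 4 by decide), mul_neg, neg_mul, h7])
  generalize hr : reProj M = r at *
  clear hr
  rw [lunit_mul_mul_of_lt (by decide)] at a3 b3 c2 c3 d3 e3 f3 g2 g3
  rw [neg_eq_iff_eq_neg] at a3 b3 c2 c3 d3 e3 f3 g2 g3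
  rw [lsmul_eq_sum, lsmul_eq_sum p, lsmul_eq_sum q]
  simp [Octonion.mul_def, mul_add, add_mul, lunit_mul_mul_self, lunit_mul_mul_of_lt, *]
  module

theorem Re_mem_realPart (x : M) : Re x ∈ realPart M := fun p q => by
  have h := congrArg (fun f : Module.End ℝ M => f x) (lsmul_mul_reProj p q)
  rw [Re_eq_reProj, sub_eq_zero]
  exact h

/-- The associator of a real element vanishes. -/
theorem lsmul_lsmul_of_mem {m : M} (hm : m ∈ realPart M) (p q : Octonion) :
    p ◃ (q ◃ m) = (p * q) ◃ m := (sub_eq_zero.1 (hm p q)).symm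

/-- On a real element each of the three pairs in `two_smul_runit_*` acts as the unit itself, so
twice the right multiplication is `3 - 1 = 2` times the left one. -/
theorem rsmul_of_mem {m : M} (hm : m ∈ realPart M) (p : Octonion) : m ▹ p = p ◃ m := by
  have key (i : Fin 7) (t : Module.End ℝ M) (h : (2 : ℝ) • runit M i = t)
      (ht : t m = (2 : ℝ) • lunit M i m) : runit M i m = lunit M i m := by
    rw [← h] at ht
    exact smul_right_injective M (two_ne_zero (α := ℝ)) ht
  have pair (i j k : Fin 7)
      (h : Octonion.e i.succ * Octonion.e j.succ = Octonion.e k.succ) :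
      lunit M i (lunit M j m) = lunit M k m := by
    rw [lunit, lunit, lsmul_lsmul_of_mem hm, h, lunit]
  change (RightOModule.rsmul p : Module.End ℝ M) m = (OBimodule.lsmul p : Module.End ℝ M) m
  rw [rsmul_eq_sum, lsmul_eq_sum]
  simp only [LinearMap.add_apply, LinearMap.smul_apply]
  rw [key 0 _ two_smul_runit_zero, key 1 _ two_smul_runit_one, key 2 _ two_smul_runit_two,
    key 3 _ two_smul_runit_three, key 4 _ two_smul_runit_four, key 5 _ two_smul_runit_five,
    key 6 _ two_smul_runit_six]
  all_goals
    simp only [LinearMap.sub_apply, LinearMap.add_apply, Module.End.mul_apply]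
  · rw [pair 2 3 6, pair 5 0 6, pair 1 4 6]
    · module
    all_goals simp [Octonion.e, Octonion.mul_def]
  · rw [pair 4 2 5, pair 0 6 5, pair 1 3 5]
    · module
    all_goals simp [Octonion.e, Octonion.mul_def]
  · rw [pair 2 5 4, pair 0 3 4, pair 6 1 4]
    · module
    all_goals simp [Octonion.e, Octonion.mul_def]
  · rw [pair 5 1 3, pair 4 0 3, pair 6 2 3]
    · module
    all_goals simp [Octonion.e, Octonion.mul_def]
  · rw [pair 3 6 2, pair 0 1 2, pair 5 4 2]
    · module
    all_goals simp [Octonion.e, Octonion.mul_def]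
  · rw [pair 4 6 1, pair 2 0 1, pair 3 5 1]
    · module
    all_goals simp [Octonion.e, Octonion.mul_def]
  · rw [pair 6 5 0, pair 1 2 0, pair 3 4 0]
    · module
    all_goals simp [Octonion.e, Octonion.mul_def]

theorem lsmul_rsmul_of_mem {m : M} (hm : m ∈ realPart M) (p q : Octonion) :
    (q ◃ m) ▹ p = (q * p) ◃ m := by
  have h := OBimodule.lassoc_eq_massoc p q m
  rw [lsmul_lsmul_of_mem hm, rsmul_of_mem hm, lsmul_lsmul_of_mem hm, sub_self] at h
  exact (sub_eq_zero.1 h.symm)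

/-- `Re` is built from the two actions, and on multiples of a real element these are octonion
products. -/
theorem Re_lsmul_of_mem {m : M} (hm : m ∈ realPart M) (q : Octonion) : Re (q ◃ m) = q.c0 • m := by
  have h : Re (q ◃ m) = Re q ◃ m := by
    simp only [Re, lsmul_lsmul_of_mem hm, lsmul_rsmul_of_mem hm, map_sub, map_smul, map_sum,
      LinearMap.sub_apply, LinearMap.smul_apply, LinearMap.sum_apply, Octonion.lsmul_eq_mul,
      Octonion.rsmul_eq_mul]
  rw [h, Octonion.Re_eq, map_smul, LinearMap.smul_apply, OBimodule.lsmul_one]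

/-- The real components of an element. -/
theorem exists_eq_sum (x : M) : ∃ m : Fin 8 → M, (∀ i, m i ∈ realPart M) ∧
    x = ∑ i, Octonion.e i ◃ m i := by
  -- The components are read off from `sum_reProj`.
  refine ⟨Fin.cons (Re x) fun i => -Re (Octonion.e i.succ ◃ x), ?_, ?_⟩
  · intro i
    refine Fin.cases ?_ (fun i => ?_) i
    · exact Re_mem_realPart x
    · intro p q
      simpa [neg_add_eq_zero, sub_eq_zero] using Re_mem_realPart (Octonion.e i.succ ◃ x) p q
  · have h := congrArg (fun f : Module.End ℝ M => f x) (sum_reProj (M := M))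
    rw [Fin.sum_univ_succ, show Octonion.e 0 = 1 from rfl, OBimodule.lsmul_one]
    simpa [Re_eq_reProj, lunit, sub_eq_add_neg] using h.symm

/-- A linear identity in `x` only has to be checked on real multiples. -/
theorem eq_of_real {N : Type*} [AddCommGroup N] [Module ℝ N] (f g : M →ₗ[ℝ] N)
    (h : ∀ m ∈ realPart M, ∀ q : Octonion, f (q ◃ m) = g (q ◃ m)) (x : M) : f x = g x := by
  obtain ⟨m, hm, rfl⟩ := exists_eq_sum x
  simp only [map_sum]
  exact Finset.sum_congr rfl fun i _ => h _ (hm i) _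

end Structure

/-! ### Norm and coordinate identities for octonions -/

namespace Octonion

theorem c0_mul_comm (p q : Octonion) : (p * q).c0 = (q * p).c0 := by
  simp only [mul_def]; ring

theorem c0_mul_assoc (p q r : Octonion) : ((p * q) * r).c0 = (p * (q * r)).c0 := by
  simp only [mul_def]; ring

theorem mul_mul_conj (q p : Octonion) : (q * p) * p.conj = (p * p.conj).c0 • q := by
  ext <;> simp only [mul_def, smul_def, conj] <;> ring

theorem conj_mul_mul (q p : Octonion) : p.conj * (p * q) = (p * p.conj).c0 • q := by
  ext <;> simp only [mul_def, smul_def, conj] <;> ring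

theorem conj_conj (p : Octonion) : p.conj.conj = p := by simp [conj]

theorem conj_mul (p q : Octonion) : (p * q).conj = q.conj * p.conj := by
  ext <;> simp only [mul_def, conj] <;> ring

theorem mul_conj_c0_nonneg (p : Octonion) : 0 ≤ (p * p.conj).c0 := by
  have : (p * p.conj).c0 = p.c0 ^ 2 + p.c1 ^ 2 + p.c2 ^ 2 + p.c3 ^ 2 + p.c4 ^ 2 + p.c5 ^ 2 +
      p.c6 ^ 2 + p.c7 ^ 2 := by
    simp only [mul_def, conj]; ring
  rw [this]; positivity

theorem norm_sq (p : Octonion) : ‖p‖ ^ 2 = (p * p.conj).c0 := Real.sq_sqrt (mul_conj_c0_nonneg p)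

theorem norm_nonneg' (p : Octonion) : 0 ≤ ‖p‖ := Real.sqrt_nonneg _

theorem norm_conj (p : Octonion) : ‖p.conj‖ = ‖p‖ := by
  change √_ = √_
  congr 1
  simp only [mul_def, conj]; ring

theorem norm_e (i : Fin 8) : ‖e i‖ = 1 := by
  change √_ = 1
  rw [Real.sqrt_eq_one]
  revert i
  simp [Fin.forall_fin_succ, e, mul_def, conj]

theorem norm_eq_zero' {p : Octonion} (h : ‖p‖ = 0) : p = 0 := by
  have h2 : p.c0 ^ 2 + p.c1 ^ 2 + p.c2 ^ 2 + p.c3 ^ 2 + p.c4 ^ 2 + p.c5 ^ 2 +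
      p.c6 ^ 2 + p.c7 ^ 2 = 0 := by
    have := norm_sq p
    rw [h] at this
    simp only [mul_def, conj] at this
    linarith
  ext <;> change _ = (0 : ℝ) <;>
    refine pow_eq_zero_iff two_ne_zero |>.1 (le_antisymm ?_ (sq_nonneg _)) <;>
    nlinarith only [h2, sq_nonneg p.c0, sq_nonneg p.c1, sq_nonneg p.c2, sq_nonneg p.c3,
      sq_nonneg p.c4, sq_nonneg p.c5, sq_nonneg p.c6, sq_nonneg p.c7]

theorem eq_sum_c0 (p : Octonion) : p = ∑ i, (e i * p).c0 • (e i).conj := by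
  simp only [Fin.sum_univ_eight]
  ext <;> simp [e, mul_def, smul_def, add_def, neg_def, conj]

theorem eq_sum_c0' (p : Octonion) : p = ∑ i, (p * (e i).conj).c0 • e i := by
  simp only [Fin.sum_univ_eight]
  ext <;> simp [e, mul_def, smul_def, add_def, conj]

theorem e_mul (p : Octonion) :
    e 0 * p = ⟨p.c0, p.c1, p.c2, p.c3, p.c4, p.c5, p.c6, p.c7⟩ ∧
    e 1 * p = ⟨-p.c1, p.c0, -p.c3, p.c2, -p.c5, p.c4, p.c7, -p.c6⟩ ∧
    e 2 * p = ⟨-p.c2, p.c3, p.c0, -p.c1, -p.c6, -p.c7, p.c4, p.c5⟩ ∧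
    e 3 * p = ⟨-p.c3, -p.c2, p.c1, p.c0, -p.c7, p.c6, -p.c5, p.c4⟩ ∧
    e 4 * p = ⟨-p.c4, p.c5, p.c6, p.c7, p.c0, -p.c1, -p.c2, -p.c3⟩ ∧
    e 5 * p = ⟨-p.c5, -p.c4, p.c7, -p.c6, p.c1, p.c0, p.c3, -p.c2⟩ ∧
    e 6 * p = ⟨-p.c6, -p.c7, -p.c4, p.c5, p.c2, -p.c3, p.c0, p.c1⟩ ∧
    e 7 * p = ⟨-p.c7, p.c6, -p.c5, -p.c4, p.c3, p.c2, -p.c1, p.c0⟩ := by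
  refine ⟨?_, ?_, ?_, ?_, ?_, ?_, ?_, ?_⟩ <;> simp [e, mul_def]

theorem mul_e (p : Octonion) :
    p * e 0 = ⟨p.c0, p.c1, p.c2, p.c3, p.c4, p.c5, p.c6, p.c7⟩ ∧
    p * e 1 = ⟨-p.c1, p.c0, p.c3, -p.c2, p.c5, -p.c4, -p.c7, p.c6⟩ ∧
    p * e 2 = ⟨-p.c2, -p.c3, p.c0, p.c1, p.c6, p.c7, -p.c4, -p.c5⟩ ∧
    p * e 3 = ⟨-p.c3, p.c2, -p.c1, p.c0, p.c7, -p.c6, p.c5, -p.c4⟩ ∧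
    p * e 4 = ⟨-p.c4, -p.c5, -p.c6, -p.c7, p.c0, p.c1, p.c2, p.c3⟩ ∧
    p * e 5 = ⟨-p.c5, p.c4, -p.c7, p.c6, -p.c1, p.c0, -p.c3, p.c2⟩ ∧
    p * e 6 = ⟨-p.c6, p.c7, p.c4, -p.c5, -p.c2, p.c3, p.c0, -p.c1⟩ ∧
    p * e 7 = ⟨-p.c7, -p.c6, p.c5, p.c4, -p.c3, -p.c2, p.c1, p.c0⟩ := by
  refine ⟨?_, ?_, ?_, ?_, ?_, ?_, ?_, ?_⟩ <;> simp [e, mul_def]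

theorem mul_conj_e (p : Octonion) :
    p * (e 0).conj = ⟨p.c0, p.c1, p.c2, p.c3, p.c4, p.c5, p.c6, p.c7⟩ ∧
    p * (e 1).conj = ⟨p.c1, -p.c0, -p.c3, p.c2, -p.c5, p.c4, p.c7, -p.c6⟩ ∧
    p * (e 2).conj = ⟨p.c2, p.c3, -p.c0, -p.c1, -p.c6, -p.c7, p.c4, p.c5⟩ ∧
    p * (e 3).conj = ⟨p.c3, -p.c2, p.c1, -p.c0, -p.c7, p.c6, -p.c5, p.c4⟩ ∧
    p * (e 4).conj = ⟨p.c4, p.c5, p.c6, p.c7, -p.c0, -p.c1, -p.c2, -p.c3⟩ ∧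
    p * (e 5).conj = ⟨p.c5, -p.c4, p.c7, -p.c6, p.c1, -p.c0, p.c3, -p.c2⟩ ∧
    p * (e 6).conj = ⟨p.c6, -p.c7, -p.c4, p.c5, p.c2, -p.c3, -p.c0, p.c1⟩ ∧
    p * (e 7).conj = ⟨p.c7, p.c6, -p.c5, -p.c4, p.c3, p.c2, -p.c1, -p.c0⟩ := by
  refine ⟨?_, ?_, ?_, ?_, ?_, ?_, ?_, ?_⟩ <;> simp [e, mul_def, conj]

/-- Left multiplication in terms of right multiplications. -/
theorem mul_eq_sum_right (p q : Octonion) :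
    p * q = (3 * p.c0) • q - (1 / 4 : ℝ) • ∑ i, (q * (e i * p)) * (e i).conj := by
  simp only [Fin.sum_univ_eight, e_mul, mul_conj_e]
  ext <;> simp only [mul_def, smul_def, add_def, sub_def] <;> ring

/-- The term-by-term adjoint of `mul_eq_sum_right`, where the adjoint of right multiplication by `a`
is right multiplication by `ā`; used for the adjoint of left multiplication in `realInner_lsmul`. -/
theorem conj_mul_eq_sum_right (p q : Octonion) :
    p.conj * q = (3 * p.c0) • q - (1 / 4 : ℝ) • ∑ i, (q * e i) * (p.conj * (e i).conj) := by
  simp only [Fin.sum_univ_eight, mul_e, mul_conj_e]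
  ext <;> simp only [conj, mul_def, smul_def, add_def, sub_def] <;> ring

end Octonion

/-! ### Real parts of multiples, and para-linear maps -/

section Structure

variable {M M' : Type*} [AddCommGroup M] [Module ℝ M] [OBimodule M]
  [AddCommGroup M'] [Module ℝ M'] [OBimodule M']

theorem Re_sub (x y : M) : Re (x - y) = Re x - Re y := by
  simp only [Re_eq_reProj, map_sub]

theorem Re_sum {ι : Type*} (s : Finset ι) (x : ι → M) : Re (∑ i ∈ s, x i) = ∑ i ∈ s, Re (x i) := by
  simp only [Re_eq_reProj, map_sum]

theorem Re_rsmul_rsmul (p q : Octonion) (x : M) : Re ((x ▹ p) ▹ q) = Re (x ▹ (p * q)) := by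
  rw [Re_eq_reProj, Re_eq_reProj]
  refine eq_of_real (reProj M ∘ₗ RightOModule.rsmul q ∘ₗ RightOModule.rsmul p)
    (reProj M ∘ₗ RightOModule.rsmul (p * q)) (fun m hm q => ?_) x
  simp only [LinearMap.comp_apply, ← Re_eq_reProj, lsmul_rsmul_of_mem hm,
    Re_lsmul_of_mem hm, Octonion.c0_mul_assoc]

/-- An element is recovered from the real parts of its right multiples, which are what
para-linearity controls. -/
theorem eq_sum_Re (x : M) : x = ∑ i, Octonion.e i ◃ Re (x ▹ (Octonion.e i).conj) := by
  have h := eq_of_real (LinearMap.id : M →ₗ[ℝ] M)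
    (∑ i, OBimodule.lsmul (Octonion.e i) ∘ₗ reProj M ∘ₗ
      RightOModule.rsmul (Octonion.e i).conj) (fun m hm q => ?_) x
  · simpa [← Re_eq_reProj] using h
  · simp only [LinearMap.id_apply, LinearMap.sum_apply, LinearMap.comp_apply, ← Re_eq_reProj,
      lsmul_rsmul_of_mem hm, Re_lsmul_of_mem hm, map_smul]
    conv_lhs => rw [Octonion.eq_sum_c0' q]
    simp only [map_sum, map_smul, LinearMap.sum_apply, LinearMap.smul_apply]

theorem eq_of_Re_rsmul {x y : M} (h : ∀ p, Re (x ▹ p) = Re (y ▹ p)) : x = y := by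
  rw [eq_sum_Re x, eq_sum_Re y]
  simp only [h]

theorem rsmul_rsmul_add (x : M) (p r : Octonion) :
    (x ▹ p) ▹ r + (x ▹ r) ▹ p = x ▹ (p * r) + x ▹ (r * p) := by
  have h := RightOModule.rassoc_swap x p r
  linear_combination (norm := module) h

theorem lsmul_rsmul_sub (r : Octonion) (x : M) (p : Octonion) :
    (r ◃ x) ▹ p - r ◃ (x ▹ p) = x ▹ (r * p) - (x ▹ r) ▹ p := by
  have h := OBimodule.massoc_eq_rassoc p r x
  have h2 := RightOModule.rassoc_swap x p r
  linear_combination (norm := module) h + h2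

theorem rsmul_rsmul_conj (x : M) (p : Octonion) : (x ▹ p) ▹ p.conj = ‖p‖ ^ 2 • x := by
  refine eq_of_real (RightOModule.rsmul p.conj ∘ₗ RightOModule.rsmul p) (‖p‖ ^ 2 • LinearMap.id)
    (fun m hm q => ?_) x
  simp [lsmul_rsmul_of_mem hm, Octonion.mul_mul_conj, Octonion.norm_sq]

theorem lsmul_conj_lsmul (x : M) (p : Octonion) : p.conj ◃ (p ◃ x) = ‖p‖ ^ 2 • x := by
  refine eq_of_real (OBimodule.lsmul p.conj ∘ₗ OBimodule.lsmul p) (‖p‖ ^ 2 • LinearMap.id)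
    (fun m hm q => ?_) x
  simp [lsmul_lsmul_of_mem hm, Octonion.conj_mul_mul, Octonion.norm_sq]

theorem lsmul_eq_sum_right (p : Octonion) (x : M) : p ◃ x = (3 * p.c0) • x -
    (1 / 4 : ℝ) • ∑ i, (x ▹ (Octonion.e i * p)) ▹ (Octonion.e i).conj := by
  have h := eq_of_real (OBimodule.lsmul p) ((3 * p.c0) • (LinearMap.id : M →ₗ[ℝ] M) -
    (1 / 4 : ℝ) • ∑ i, RightOModule.rsmul (Octonion.e i).conj ∘ₗ
      RightOModule.rsmul (Octonion.e i * p)) (fun m hm q => ?_) x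
  · simpa using h
  · have := congrArg (fun u => u ◃ m) (Octonion.mul_eq_sum_right p q)
    simpa [lsmul_lsmul_of_mem hm, lsmul_rsmul_of_mem hm] using this

theorem lsmul_conj_eq_sum_right (p : Octonion) (x : M) : p.conj ◃ x = (3 * p.c0) • x -
    (1 / 4 : ℝ) • ∑ i, (x ▹ Octonion.e i) ▹ (p.conj * (Octonion.e i).conj) := by
  have h := eq_of_real (OBimodule.lsmul p.conj) ((3 * p.c0) • (LinearMap.id : M →ₗ[ℝ] M) -
    (1 / 4 : ℝ) • ∑ i, RightOModule.rsmul (p.conj * (Octonion.e i).conj) ∘ₗ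
      RightOModule.rsmul (Octonion.e i)) (fun m hm q => ?_) x
  · simpa using h
  · have := congrArg (fun u => u ◃ m) (Octonion.conj_mul_eq_sum_right p q)
    simpa [lsmul_lsmul_of_mem hm, lsmul_rsmul_of_mem hm] using this

/-! ### Para-linear maps -/

theorem isRightParaLinear_iff {f : M →ₗ[ℝ] M'} :
    IsRightParaLinear f ↔ ∀ p x, Re (f (x ▹ p)) = Re (f x ▹ p) := by
  simp only [IsRightParaLinear, B, Re_sub, sub_eq_zero]
  exact forall₂_congr fun p x => eq_comm

theorem IsRightParaLinear.ext {f g : M →ₗ[ℝ] M'} (hf : IsRightParaLinear f)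
    (hg : IsRightParaLinear g) (h : ∀ x, Re (f x) = Re (g x)) : f = g := by
  ext x
  refine eq_of_Re_rsmul fun p => ?_
  rw [← isRightParaLinear_iff.1 hf, ← isRightParaLinear_iff.1 hg, h]

theorem IsRightParaLinear.map_rsmul_of_mem {f : M →ₗ[ℝ] M'} (hf : IsRightParaLinear f) {m : M}
    (hm : m ∈ realPart M) (p : Octonion) : f (m ▹ p) = f m ▹ p := by
  refine eq_of_Re_rsmul fun q => ?_
  rw [← isRightParaLinear_iff.1 hf, Re_rsmul_rsmul, ← isRightParaLinear_iff.1 hf,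
    rsmul_of_mem hm, rsmul_of_mem hm, lsmul_rsmul_of_mem hm]

/-- The para-linear map with the same real part as `f`. -/
noncomputable def paraExtend (f : M →ₗ[ℝ] M') : M →ₗ[ℝ] M' :=
  ∑ i, OBimodule.lsmul (Octonion.e i) ∘ₗ reProj M' ∘ₗ f ∘ₗ RightOModule.rsmul (Octonion.e i).conj

theorem paraExtend_apply (f : M →ₗ[ℝ] M') (x : M) :
    paraExtend f x = ∑ i, Octonion.e i ◃ Re (f (x ▹ (Octonion.e i).conj)) := by
  simp [paraExtend, Re_eq_reProj]

/-- Multiplying by `p` weights the `i`-th term by the real part of `e_i p`, and `∑ Re (e_i p) ē_i =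
p`. -/
theorem Re_paraExtend_rsmul (f : M →ₗ[ℝ] M') (x : M) (p : Octonion) :
    Re (paraExtend f x ▹ p) = Re (f (x ▹ p)) := by
  rw [paraExtend_apply]
  simp only [map_sum, Re_sum, lsmul_rsmul_of_mem (Re_mem_realPart _),
    Re_lsmul_of_mem (Re_mem_realPart _)]
  conv_rhs => rw [Octonion.eq_sum_c0 p]
  simp only [map_sum, map_smul, LinearMap.sum_apply, LinearMap.smul_apply, Re_sum, Re_smul]

theorem Re_paraExtend (f : M →ₗ[ℝ] M') (x : M) : Re (paraExtend f x) = Re (f x) := by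
  simpa [RightOModule.rsmul_one] using Re_paraExtend_rsmul f x 1

theorem isRightParaLinear_paraExtend (f : M →ₗ[ℝ] M') : IsRightParaLinear (paraExtend f) :=
  isRightParaLinear_iff.2 fun p x => by rw [Re_paraExtend, Re_paraExtend_rsmul]

end Structure

theorem Re_lsmul_rsmul {M : Type*} [AddCommGroup M] [Module ℝ M] [OBimodule M] (p q : Octonion)
    (x : M) : Re ((p ◃ x) ▹ q) = Re (x ▹ (q * p)) := by
  rw [Re_eq_reProj, Re_eq_reProj]
  refine eq_of_real (reProj M ∘ₗ RightOModule.rsmul q ∘ₗ OBimodule.lsmul p)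
    (reProj M ∘ₗ RightOModule.rsmul (q * p)) (fun m hm r => ?_) x
  simp only [LinearMap.comp_apply, ← Re_eq_reProj, lsmul_rsmul_of_mem hm, lsmul_lsmul_of_mem hm,
    Re_lsmul_of_mem hm, Octonion.c0_mul_comm _ q, Octonion.c0_mul_comm r, Octonion.c0_mul_assoc]

/-! ### Adjoints and norms of multiplications on a Hilbert bimodule -/

section Hilbert

variable {H : Type*} [NormedAddCommGroup H] [NormedSpace ℝ H] [PreHilbertOBimodule H]

/-- The real inner product of a pre-Hilbert bimodule. -/
noncomputable def realInner (u v : H) : ℝ := (PreHilbertOBimodule.inner u v).c0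

theorem realInner_comm (u v : H) : realInner u v = realInner v u := by
  rw [realInner, PreHilbertOBimodule.inner_hermitian]; rfl

theorem realInner_self (u : H) : realInner u u = ‖u‖ ^ 2 := by
  obtain ⟨r, hr, h⟩ := PreHilbertOBimodule.inner_self_nonneg u
  rw [PreHilbertOBimodule.norm_eq_sqrt, realInner, h,
    Real.sq_sqrt (show 0 ≤ (Octonion.ofReal r).c0 from hr)]

theorem realInner_add_right (u v w : H) :
    realInner u (v + w) = realInner u v + realInner u w := by
  simp [realInner, Octonion.add_def]

theorem realInner_smul_right (u v : H) (c : ℝ) : realInner u (c • v) = c * realInner u v := by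
  simp [realInner, Octonion.smul_def]

theorem realInner_sub_right (u v w : H) :
    realInner u (v - w) = realInner u v - realInner u w := by
  simp [realInner, Octonion.sub_def]

theorem realInner_sum_right {ι : Type*} (s : Finset ι) (u : H) (v : ι → H) :
    realInner u (∑ i ∈ s, v i) = ∑ i ∈ s, realInner u (v i) := by
  classical
  induction s using Finset.induction_on with
  | empty => simp [realInner, Octonion.zero_def]
  | insert a s ha ih => rw [Finset.sum_insert ha, Finset.sum_insert ha, realInner_add_right, ih]

theorem inner_rsmul_c0 (u v : H) (p : Octonion) :
    (PreHilbertOBimodule.inner u v * p).c0 = realInner u (v ▹ p) := by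
  have h := PreHilbertOBimodule.inner_paraLinear u p v
  rw [B, Re_sub, sub_eq_zero, Octonion.Re_eq, Octonion.Re_eq] at h
  simpa [Octonion.one_def, Octonion.smul_def, Octonion.rsmul_eq_mul, realInner] using
    congrArg Octonion.c0 h

theorem realInner_rsmul (u v : H) (p : Octonion) :
    realInner (u ▹ p) v = realInner u (v ▹ p.conj) := by
  rw [realInner_comm, ← inner_rsmul_c0, ← inner_rsmul_c0, PreHilbertOBimodule.inner_hermitian]
  simp only [Octonion.mul_def, Octonion.conj]; ring

/-- The inner product axioms mention only the right action, so left multiplication is first written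
through right multiplications. -/
theorem realInner_lsmul (u v : H) (p : Octonion) :
    realInner (p ◃ u) v = realInner u (p.conj ◃ v) := by
  rw [lsmul_eq_sum_right, lsmul_conj_eq_sum_right]
  rw [realInner_comm _ v]
  simp only [realInner_sub_right, realInner_smul_right, realInner_sum_right]
  rw [realInner_comm v u]
  congr 2
  refine Finset.sum_congr rfl fun i _ => ?_
  rw [realInner_comm v, realInner_rsmul, realInner_rsmul, Octonion.conj_conj, Octonion.conj_mul]

theorem norm_rsmul (x : H) (p : Octonion) : ‖x ▹ p‖ = ‖p‖ * ‖x‖ := by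
  rw [← sq_eq_sq₀ (norm_nonneg _) (mul_nonneg p.norm_nonneg' (norm_nonneg _)),
    ← realInner_self, realInner_rsmul, rsmul_rsmul_conj, realInner_smul_right, realInner_self,
    mul_pow]

theorem norm_lsmul (x : H) (p : Octonion) : ‖p ◃ x‖ = ‖p‖ * ‖x‖ := by
  rw [← sq_eq_sq₀ (norm_nonneg _) (mul_nonneg p.norm_nonneg' (norm_nonneg _)),
    ← realInner_self, realInner_lsmul, lsmul_conj_lsmul, realInner_smul_right, realInner_self,
    mul_pow]

theorem norm_Re_le (x : H) : ‖Re x‖ ≤ ‖x‖ := by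
  have h : ‖∑ i : Fin 7, (Octonion.e i.succ ◃ x) ▹ Octonion.e i.succ‖ ≤ 7 * ‖x‖ := by
    refine (norm_sum_le _ _).trans ?_
    simp [norm_rsmul, norm_lsmul, Octonion.norm_e]
  -- `5/12 + 7/12 = 1`.
  refine (norm_sub_le _ _).trans ?_
  rw [norm_smul, norm_smul]
  norm_num
  linarith

variable (H) in
/-- Left multiplication as a continuous linear map. -/
noncomputable def lsmulCLM (p : Octonion) : H →L[ℝ] H :=
  (OBimodule.lsmul p : H →ₗ[ℝ] H).mkContinuous ‖p‖ fun x => (norm_lsmul x p).le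

variable (H) in
/-- Right multiplication as a continuous linear map. -/
noncomputable def rsmulCLM (p : Octonion) : H →L[ℝ] H :=
  (RightOModule.rsmul p : H →ₗ[ℝ] H).mkContinuous ‖p‖ fun x => (norm_rsmul x p).le

theorem continuous_Re : Continuous (Re : H → H) := by
  have h := (LinearMap.mkContinuous (reProj H) 1 fun x => by
    rw [← Re_eq_reProj, one_mul]; exact norm_Re_le x).continuous
  exact h.congr fun x => (Re_eq_reProj x).symm

end Hilbert

/-! ### The actions on operators -/

section Operators

variable {H₁ H₂ H₃ : Type*} [NormedAddCommGroup H₁] [NormedSpace ℝ H₁] [PreHilbertOBimodule H₁]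
  [NormedAddCommGroup H₂] [NormedSpace ℝ H₂] [PreHilbertOBimodule H₂]
  [NormedAddCommGroup H₃] [NormedSpace ℝ H₃] [PreHilbertOBimodule H₃]

namespace BRO

theorem Re_map_rsmul (T : BRO H₁ H₂) (p : Octonion) (x : H₁) :
    Re (T.1 (x ▹ p)) = Re (T.1 x ▹ p) :=
  isRightParaLinear_iff.1 T.2 p x

theorem ext_Re {S T : BRO H₁ H₂} (h : ∀ x, Re (S.1 x) = Re (T.1 x)) : S = T :=
  Subtype.ext (ContinuousLinearMap.coe_injective (S.2.ext T.2 h))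

theorem map_rsmul_of_mem (T : BRO H₁ H₂) {m : H₁} (hm : m ∈ realPart H₁) (p : Octonion) :
    T.1 (m ▹ p) = T.1 m ▹ p :=
  T.2.map_rsmul_of_mem hm p

/-- `Re ((r T(x) + B_r(T, x)) p)`. -/
theorem Re_left_rsmul (T : BRO H₁ H₂) (r p : Octonion) (x : H₁) :
    Re ((r ◃ T.1 x + (T.1 x ▹ r - T.1 (x ▹ r))) ▹ p) = Re (T.1 ((x ▹ p) ▹ r)) := by
  have h := congrArg (fun y => Re (T.1 y)) (rsmul_rsmul_add x p r)
  simp only [map_add, Re_add] at h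
  rw [map_add, map_sub, Re_add, Re_sub, Re_lsmul_rsmul, Re_rsmul_rsmul, ← Re_map_rsmul,
    ← Re_map_rsmul, ← Re_map_rsmul]
  linear_combination (norm := module) -h

theorem Re_right_rsmul (T : BRO H₁ H₂) (r p : Octonion) (x : H₁) :
    Re ((T.1 (r ◃ x) - (T.1 x ▹ r - T.1 (x ▹ r))) ▹ p) = Re (T.1 (r ◃ (x ▹ p))) := by
  have h := congrArg (fun y => Re (T.1 y)) (lsmul_rsmul_sub r x p)
  simp only [map_sub, Re_sub] at h
  rw [map_sub, map_sub, Re_sub, Re_sub, Re_rsmul_rsmul, ← Re_map_rsmul, ← Re_map_rsmul,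
    ← Re_map_rsmul]
  linear_combination (norm := module) h

/-- `r ⊙ T`. -/
noncomputable def left (r : Octonion) (T : BRO H₁ H₂) : BRO H₁ H₂ :=
  ⟨lsmulCLM H₂ r ∘L T.1 + (rsmulCLM H₂ r ∘L T.1 - T.1 ∘L rsmulCLM H₁ r),
    isRightParaLinear_iff.2 fun p x => by
      -- Para-linearity compares the formula for `p` at `x` with the one for `1` at `x p`.
      have h1 := Re_left_rsmul T r p x
      have h2 := Re_left_rsmul T r 1 (x ▹ p)
      simp only [RightOModule.rsmul_one] at h2
      exact h2.trans h1.symm⟩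

/-- `T ⊙ r`. -/
noncomputable def right (r : Octonion) (T : BRO H₁ H₂) : BRO H₁ H₂ :=
  ⟨T.1 ∘L lsmulCLM H₁ r - (rsmulCLM H₂ r ∘L T.1 - T.1 ∘L rsmulCLM H₁ r),
    isRightParaLinear_iff.2 fun p x => by
      have h1 := Re_right_rsmul T r p x
      have h2 := Re_right_rsmul T r 1 (x ▹ p)
      simp only [RightOModule.rsmul_one] at h2
      exact h2.trans h1.symm⟩

theorem left_apply (r : Octonion) (T : BRO H₁ H₂) (x : H₁) :
    (left r T).1 x = r ◃ T.1 x + (T.1 x ▹ r - T.1 (x ▹ r)) := rfl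

theorem right_apply (r : Octonion) (T : BRO H₁ H₂) (x : H₁) :
    (right r T).1 x = T.1 (r ◃ x) - (T.1 x ▹ r - T.1 (x ▹ r)) := rfl

theorem Re_left (r : Octonion) (T : BRO H₁ H₂) (x : H₁) :
    Re ((left r T).1 x) = Re (T.1 (x ▹ r)) := by
  simpa [left_apply, RightOModule.rsmul_one] using Re_left_rsmul T r 1 x

theorem Re_right (r : Octonion) (T : BRO H₁ H₂) (x : H₁) :
    Re ((right r T).1 x) = Re (T.1 (r ◃ x)) := by
  simpa [right_apply, RightOModule.rsmul_one] using Re_right_rsmul T r 1 x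

end BRO

end Operators

/-! ### Norms, bimodule axioms, completeness and regular composition -/

theorem Octonion.mul_conj_sandwich (r q p : Octonion) :
    (q * r.conj) * ((r * p) * r) = ‖r‖ ^ 2 • ((q * p) * r) := by
  rw [Octonion.norm_sq]
  ext <;> simp only [Octonion.mul_def, Octonion.smul_def, Octonion.conj] <;> ring

/-- The left Moufang identity `(r q r) y = r (q (r y))` at `y = r̄ p`; the preceding lemma is the
right one. -/
theorem Octonion.sandwich_mul_conj (r q p : Octonion) :
    ((r * q) * r) * (r.conj * p) = ‖r‖ ^ 2 • (r * (q * p)) := by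
  rw [Octonion.norm_sq]
  ext <;> simp only [Octonion.mul_def, Octonion.smul_def, Octonion.conj] <;> ring

section Operators

variable {H₁ H₂ H₃ : Type*} [NormedAddCommGroup H₁] [NormedSpace ℝ H₁] [PreHilbertOBimodule H₁]
  [NormedAddCommGroup H₂] [NormedSpace ℝ H₂] [PreHilbertOBimodule H₂]
  [NormedAddCommGroup H₃] [NormedSpace ℝ H₃] [PreHilbertOBimodule H₃]

namespace BRO

theorem add_apply (S T : BRO H₁ H₂) (x : H₁) : (S + T).1 x = S.1 x + T.1 x := rfl

theorem sub_apply (S T : BRO H₁ H₂) (x : H₁) : (S - T).1 x = S.1 x - T.1 x := rfl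

theorem neg_apply (T : BRO H₁ H₂) (x : H₁) : (-T).1 x = -T.1 x := rfl

theorem smul_apply (c : ℝ) (T : BRO H₁ H₂) (x : H₁) : (c • T).1 x = c • T.1 x := rfl

theorem norm_smul' (c : ℝ) (T : BRO H₁ H₂) : ‖c • T‖ = |c| * ‖T‖ :=
  norm_smul c T.1

/-- Bounding the defining three-term formula termwise would give only `3 |r| ‖T‖`; a single
composite with multiplications that scale the norm gives the sharp constant. -/
theorem norm_sq_smul_left (r : Octonion) (T : BRO H₁ H₂) (x : H₁) :
    ‖r‖ ^ 2 • (left r T).1 x = (r ◃ T.1 (x ▹ r.conj)) ▹ r := by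
  refine eq_of_Re_rsmul fun p => ?_
  have h : (x ▹ r.conj) ▹ ((r * p) * r) = ‖r‖ ^ 2 • ((x ▹ p) ▹ r) := by
    refine eq_of_real (RightOModule.rsmul ((r * p) * r) ∘ₗ RightOModule.rsmul r.conj)
      (‖r‖ ^ 2 • (RightOModule.rsmul r ∘ₗ RightOModule.rsmul p)) (fun m hm q => ?_) x
    simp [lsmul_rsmul_of_mem hm, Octonion.mul_conj_sandwich]
  rw [map_smul, Re_smul, ← Re_map_rsmul, Re_left, Re_rsmul_rsmul, Re_lsmul_rsmul,
    ← Re_map_rsmul, h, map_smul, Re_smul]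

theorem norm_sq_smul_right (r : Octonion) (T : BRO H₁ H₂) (x : H₁) :
    ‖r‖ ^ 2 • (right r T).1 x = T.1 ((r ◃ x) ▹ r) ▹ r.conj := by
  refine eq_of_Re_rsmul fun p => ?_
  have h : ((r ◃ x) ▹ r) ▹ (r.conj * p) = ‖r‖ ^ 2 • (r ◃ (x ▹ p)) := by
    refine eq_of_real (RightOModule.rsmul (r.conj * p) ∘ₗ RightOModule.rsmul r ∘ₗ
      OBimodule.lsmul r) (‖r‖ ^ 2 • (OBimodule.lsmul r ∘ₗ RightOModule.rsmul p))
      (fun m hm q => ?_) x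
    simp [lsmul_rsmul_of_mem hm, lsmul_lsmul_of_mem hm, Octonion.sandwich_mul_conj]
  rw [map_smul, Re_smul, ← Re_map_rsmul, Re_right, Re_rsmul_rsmul, ← Re_map_rsmul, h, map_smul,
    Re_smul]

theorem norm_left_le (r : Octonion) (T : BRO H₁ H₂) : ‖left r T‖ ≤ ‖r‖ * ‖T‖ := by
  change ‖(left r T).1‖ ≤ ‖r‖ * ‖T.1‖
  rcases (r.norm_nonneg').eq_or_lt with h0 | h0
  · have h : left r T = 0 := ext_Re fun x => by
      rw [Re_left, Octonion.norm_eq_zero' h0.symm]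
      simp
    rw [h, ← h0]
    simp
  · refine ContinuousLinearMap.opNorm_le_bound _ (mul_nonneg h0.le (norm_nonneg _)) fun x => ?_
    have h := congrArg norm (norm_sq_smul_left r T x)
    rw [norm_smul, norm_rsmul, norm_lsmul, Real.norm_of_nonneg (sq_nonneg _)] at h
    have h2 : ‖(left r T).1 x‖ = ‖T.1 (x ▹ r.conj)‖ := by
      field_simp at h
      linarith
    rw [h2]
    refine (T.1.le_opNorm _).trans ?_
    rw [norm_rsmul, Octonion.norm_conj]
    exact le_of_eq (by ring)

theorem norm_right_le (r : Octonion) (T : BRO H₁ H₂) : ‖right r T‖ ≤ ‖r‖ * ‖T‖ := by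
  change ‖(right r T).1‖ ≤ ‖r‖ * ‖T.1‖
  rcases (r.norm_nonneg').eq_or_lt with h0 | h0
  · have h : right r T = 0 := ext_Re fun x => by
      rw [Re_right, Octonion.norm_eq_zero' h0.symm]
      simp
    rw [h, ← h0]
    simp
  · refine ContinuousLinearMap.opNorm_le_bound _ (mul_nonneg h0.le (norm_nonneg _)) fun x => ?_
    have h := congrArg norm (norm_sq_smul_right r T x)
    rw [norm_smul, norm_rsmul, Octonion.norm_conj, Real.norm_of_nonneg (sq_nonneg _)] at h
    have h2 := T.1.le_opNorm ((r ◃ x) ▹ r)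
    rw [norm_rsmul, norm_lsmul] at h2
    have h3 := mul_le_mul_of_nonneg_right h2 h0.le
    rw [mul_comm, ← h] at h3
    refine le_of_mul_le_mul_left (h3.trans_eq ?_) (pow_pos h0 2)
    ring

variable (H₁ H₂) in
/-- The bimodule structure on the bounded para-linear operators. -/
@[reducible]
noncomputable def bimodule : OBimodule (BRO H₁ H₂) where
  lsmul := LinearMap.mk₂ ℝ left
    (fun r s T => ext_Re fun x => by
      simp only [Re_left, add_apply, Re_add, map_add, LinearMap.add_apply])
    (fun c r T => ext_Re fun x => by
      simp only [Re_left, smul_apply, Re_smul, map_smul, LinearMap.smul_apply])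
    (fun r S T => ext_Re fun x => by simp only [Re_left, add_apply, Re_add])
    (fun c r T => ext_Re fun x => by simp only [Re_left, smul_apply, Re_smul])
  rsmul := LinearMap.mk₂ ℝ right
    (fun r s T => ext_Re fun x => by
      simp only [Re_right, add_apply, Re_add, map_add, LinearMap.add_apply])
    (fun c r T => ext_Re fun x => by
      simp only [Re_right, smul_apply, Re_smul, map_smul, LinearMap.smul_apply])
    (fun r S T => ext_Re fun x => by simp only [Re_right, add_apply, Re_add])
    (fun c r T => ext_Re fun x => by simp only [Re_right, smul_apply, Re_smul])
  lsmul_one T := ext_Re fun x => by simp [Re_left, RightOModule.rsmul_one]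
  rsmul_one T := ext_Re fun x => by simp [Re_right, OBimodule.lsmul_one]
  -- Moving the actions to the argument turns `[T, p, q]`, `[p, q, T]` and `[q, T, p]` into `-T [p,
  -- q, x]`, `-T [x, p, q]` and `T [p, x, q]` on real parts.
  rassoc_swap T p q := ext_Re fun x => by
    have h := congrArg (fun y => Re (T.1 y)) (associator_swap p q x)
    simp only [map_sub, Re_sub, ← neg_one_smul ℝ (_ - _), map_smul, Re_smul,
      LinearMap.mk₂_apply, sub_apply, smul_apply, Re_right] at h ⊢
    linear_combination (norm := module) -h
  lassoc_eq_massoc p q T := ext_Re fun x => by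
    have h := congrArg (fun y => Re (T.1 y)) (OBimodule.massoc_eq_rassoc q p x)
    have h' := congrArg (fun y => Re (T.1 y)) (RightOModule.rassoc_swap x p q)
    simp only [map_sub, Re_sub, ← neg_one_smul ℝ (_ - _), map_smul, Re_smul,
      LinearMap.mk₂_apply, sub_apply, Re_right, Re_left] at h h' ⊢
    linear_combination (norm := module) -h - h'
  massoc_eq_rassoc p q T := ext_Re fun x => by
    have h := congrArg (fun y => Re (T.1 y)) (OBimodule.lassoc_eq_massoc q p x)
    have h' := congrArg (fun y => Re (T.1 y)) (associator_swap p q x)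
    simp only [map_sub, Re_sub, ← neg_one_smul ℝ (_ - _), map_smul, Re_smul,
      LinearMap.mk₂_apply, sub_apply, Re_right, Re_left] at h h' ⊢
    linear_combination (norm := module) h' - h
  rassoc_eq_neg_lassoc p q T := ext_Re fun x => by
    have h := congrArg (fun y => Re (T.1 y)) (OBimodule.rassoc_eq_neg_lassoc q p x)
    simp only [map_sub, Re_sub, ← neg_one_smul ℝ (_ - _), map_smul, Re_smul,
      LinearMap.mk₂_apply, sub_apply, smul_apply, Re_right, Re_left] at h ⊢
    linear_combination (norm := module) -h

theorem isOperatorAction_bimodule : IsOperatorAction (bimodule H₁ H₂) :=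
  fun _ _ _ => ⟨rfl, rfl⟩

/-- The reverse inequality is `norm_left_le` for `r̄`, because `r̄ ⊙ (r ⊙ T) = |r|² T`. -/
theorem norm_left (r : Octonion) (T : BRO H₁ H₂) : ‖left r T‖ = ‖r‖ * ‖T‖ := by
  refine (norm_left_le r T).antisymm ?_
  rcases (r.norm_nonneg').eq_or_lt with h0 | h0
  · rw [← h0, zero_mul]; exact norm_nonneg _
  have h : left r.conj (left r T) = ‖r‖ ^ 2 • T := ext_Re fun x => by
    have h := rsmul_rsmul_conj x r.conj
    rw [Octonion.conj_conj, Octonion.norm_conj] at h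
    rw [Re_left, Re_left, h, map_smul, smul_apply]
  have h2 := norm_left_le r.conj (left r T)
  rw [h, norm_smul', abs_of_nonneg (sq_nonneg _), Octonion.norm_conj, pow_two,
    mul_assoc] at h2
  exact le_of_mul_le_mul_left h2 h0

theorem norm_right (r : Octonion) (T : BRO H₁ H₂) : ‖right r T‖ = ‖r‖ * ‖T‖ := by
  refine (norm_right_le r T).antisymm ?_
  rcases (r.norm_nonneg').eq_or_lt with h0 | h0
  · rw [← h0, zero_mul]; exact norm_nonneg _
  have h : right r.conj (right r T) = ‖r‖ ^ 2 • T := ext_Re fun x => by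
    have h := lsmul_conj_lsmul x r.conj
    rw [Octonion.conj_conj, Octonion.norm_conj] at h
    rw [Re_right, Re_right, h, map_smul, smul_apply]
  have h2 := norm_right_le r.conj (right r T)
  rw [h, norm_smul', abs_of_nonneg (sq_nonneg _), Octonion.norm_conj, pow_two,
    mul_assoc] at h2
  exact le_of_mul_le_mul_left h2 h0

theorem isClosed : IsClosed (BRO H₁ H₂ : Set (H₁ →L[ℝ] H₂)) := by
  have h : (BRO H₁ H₂ : Set (H₁ →L[ℝ] H₂)) =
      ⋂ (p : Octonion) (x : H₁), {T | Re (rsmulCLM H₂ p (T x) - T (x ▹ p)) = 0} := by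
    ext T
    simp only [Set.mem_iInter]
    rfl
  rw [h]
  refine isClosed_iInter fun p => isClosed_iInter fun x => ?_
  refine isClosed_eq (continuous_Re.comp ?_) continuous_const
  exact ((rsmulCLM H₂ p).continuous.comp (ContinuousLinearMap.apply ℝ H₂ x).continuous).sub
    (ContinuousLinearMap.apply ℝ H₂ (x ▹ p)).continuous

theorem isBanachOBimodule [CompleteSpace H₂] :
    IsBanachOBimodule (bimodule H₁ H₂) (fun T => ‖T‖) where
  nonneg := norm_nonneg
  eq_zero_iff _ := norm_eq_zero
  add_le := norm_add_le
  real_smul := norm_smul'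
  complete u hu := by
    have : CompleteSpace (BRO H₁ H₂) := isClosed.completeSpace_coe
    have hc : CauchySeq u := Metric.cauchySeq_iff.2 fun ε hε => by
      obtain ⟨n₀, h⟩ := hu ε hε
      exact ⟨n₀, fun m hm n hn => (dist_eq_norm (u m).1 (u n).1).trans_lt (h m hm n hn)⟩
    obtain ⟨x, hx⟩ := cauchySeq_tendsto_of_complete hc
    exact ⟨x, tendsto_iff_norm_sub_tendsto_zero.1 hx⟩
  lsmul := norm_left
  rsmul := norm_right

/-- There are eight basis octonions; multiplication by each is isometric and `Re` is a contraction.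
-/
theorem norm_paraExtend_le (S : BRO H₂ H₃) (T : BRO H₁ H₂) (x : H₁) :
    ‖paraExtend ((S.1 : H₂ →ₗ[ℝ] H₃) ∘ₗ (T.1 : H₁ →ₗ[ℝ] H₂)) x‖ ≤ 8 * ‖S‖ * ‖T‖ * ‖x‖ := by
  rw [paraExtend_apply]
  refine (norm_sum_le _ _).trans ?_
  have h (i : Fin 8) : ‖Octonion.e i ◃ Re (S.1 (T.1 (x ▹ (Octonion.e i).conj)))‖ ≤
      ‖S‖ * ‖T‖ * ‖x‖ := by
    rw [norm_lsmul, Octonion.norm_e, one_mul]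
    refine (norm_Re_le _).trans ((S.1.le_opNorm_of_le (T.1.le_opNorm _)).trans_eq ?_)
    rw [norm_rsmul, Octonion.norm_conj, Octonion.norm_e, one_mul, mul_assoc]
    rfl
  refine (Finset.sum_le_sum fun i _ => h i).trans_eq ?_
  rw [Finset.sum_const, Finset.card_univ, Fintype.card_fin, nsmul_eq_mul]
  push_cast
  ring

/-- The regular composition. -/
noncomputable def comp (S : BRO H₂ H₃) (T : BRO H₁ H₂) : BRO H₁ H₃ :=
  ⟨(paraExtend ((S.1 : H₂ →ₗ[ℝ] H₃) ∘ₗ (T.1 : H₁ →ₗ[ℝ] H₂))).mkContinuous (8 * ‖S‖ * ‖T‖)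
    (norm_paraExtend_le S T), isRightParaLinear_paraExtend _⟩

theorem Re_comp (S : BRO H₂ H₃) (T : BRO H₁ H₂) (x : H₁) :
    Re ((comp S T).1 x) = Re (S.1 (T.1 x)) :=
  Re_paraExtend _ x

theorem norm_comp_le (S : BRO H₂ H₃) (T : BRO H₁ H₂) : ‖comp S T‖ ≤ 8 * ‖S‖ * ‖T‖ :=
  LinearMap.mkContinuous_norm_le _
    (mul_nonneg (mul_nonneg (by norm_num) (norm_nonneg _)) (norm_nonneg _))
    (norm_paraExtend_le S T)

theorem isRegularComp_iff (S : BRO H₂ H₃) (T : BRO H₁ H₂) (h : H₁ →ₗ[ℝ] H₃) :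
    IsRegularComp (S.1 : H₂ →ₗ[ℝ] H₃) (T.1 : H₁ →ₗ[ℝ] H₂) h ↔
      h = ((comp S T).1 : H₁ →ₗ[ℝ] H₃) := by
  refine ⟨fun hh => hh.1.ext (comp S T).2 fun x => (hh.2 x).trans (Re_comp S T x).symm, ?_⟩
  rintro rfl
  exact ⟨(comp S T).2, Re_comp S T⟩

end BRO

end Operators

/-! ### The algebra of bounded para-linear operators -/

section Algebra

theorem IsBanachOBimodule.const_mul {U : Type*} [AddCommGroup U] [Module ℝ U] {S : OBimodule U}
    {N : U → ℝ} (h : IsBanachOBimodule S N) {c : ℝ} (hc : 0 < c) :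
    IsBanachOBimodule S (fun x => c * N x) where
  nonneg x := mul_nonneg hc.le (h.nonneg x)
  eq_zero_iff x := by rw [mul_eq_zero, h.eq_zero_iff]; simp [hc.ne']
  add_le x y := by rw [← mul_add]; exact mul_le_mul_of_nonneg_left (h.add_le x y) hc.le
  real_smul a x := by rw [h.real_smul, mul_left_comm]
  complete u hu := by
    obtain ⟨x, hx⟩ := h.complete u fun ε hε => by
      obtain ⟨n₀, hn⟩ := hu (c * ε) (mul_pos hc hε)
      exact ⟨n₀, fun m hm n hn' => lt_of_mul_lt_mul_left (hn m hm n hn') hc.le⟩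
    exact ⟨x, by simpa using hx.const_mul c⟩
  lsmul p x := by rw [h.lsmul, mul_left_comm]
  rsmul p x := by rw [h.rsmul, mul_left_comm]

variable {H₁ H₂ H₃ : Type*} [NormedAddCommGroup H₁] [NormedSpace ℝ H₁] [PreHilbertOBimodule H₁]
  [NormedAddCommGroup H₂] [NormedSpace ℝ H₂] [PreHilbertOBimodule H₂]
  [NormedAddCommGroup H₃] [NormedSpace ℝ H₃] [PreHilbertOBimodule H₃]

namespace BRO

theorem map_lsmul_of_mem (T : BRO H₁ H₂) {m : H₁} (hm : m ∈ realPart H₁) (p : Octonion) :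
    T.1 (p ◃ m) = T.1 m ▹ p := by
  rw [← rsmul_of_mem hm, map_rsmul_of_mem T hm]

theorem sum_apply {ι : Type*} (s : Finset ι) (T : ι → BRO H₁ H₂) (x : H₁) :
    (∑ i ∈ s, T i).1 x = ∑ i ∈ s, (T i).1 x := by
  simp

/-- The real part of an operator is determined by its values on real elements. -/
theorem Re_Re_apply (T : BRO H₁ H₂) (x : H₁) :
    Re ((letI := bimodule H₁ H₂; Re T).1 x) = Re (T.1 (Re x)) := by
  let := bimodule H₁ H₂
  -- Both actions pass to the argument, so `Re` of the operator becomes `Re` of `x`.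
  have h (i : Fin 8) : Re (((Octonion.e i ◃ T) ▹ Octonion.e i).1 x) =
      Re (T.1 ((Octonion.e i ◃ x) ▹ Octonion.e i)) :=
    (Re_right _ _ _).trans (Re_left _ _ _)
  simp only [Re.eq_1 T, Re.eq_1 x, sub_apply, smul_apply, sum_apply, Re_sub, Re_smul, Re_sum, h,
    map_sub, map_smul, map_sum]

/-- Reduces para-linearity of the multiplication to real elements, where operators commute with
right multiplication and `B` vanishes. -/
theorem Re_eq_zero {T : BRO H₁ H₂} (h : ∀ m ∈ realPart H₁, Re (T.1 m) = 0) :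
    (letI := bimodule H₁ H₂; Re T) = 0 :=
  ext_Re fun x => by
    rw [Re_Re_apply, h _ (Re_mem_realPart x)]
    exact Re_zero.symm

variable (H₁ H₂ H₃) in
/-- The regular composition as a bilinear map. -/
noncomputable def compL : BRO H₂ H₃ →ₗ[ℝ] BRO H₁ H₂ →ₗ[ℝ] BRO H₁ H₃ :=
  LinearMap.mk₂ ℝ comp
    (fun R S T => ext_Re fun x => by simp only [Re_comp, add_apply, Re_add])
    (fun c S T => ext_Re fun x => by simp only [Re_comp, smul_apply, Re_smul])
    (fun R S T => ext_Re fun x => by simp only [Re_comp, add_apply, map_add, Re_add])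
    (fun c S T => ext_Re fun x => by simp only [Re_comp, smul_apply, map_smul, Re_smul])

variable {H : Type*} [NormedAddCommGroup H] [NormedSpace ℝ H] [PreHilbertOBimodule H]

variable (H) in
/-- The identity operator. -/
noncomputable def one : BRO H H :=
  ⟨ContinuousLinearMap.id ℝ H, isRightParaLinear_iff.2 fun _ _ => rfl⟩

theorem Re_one (x : H) : Re ((one H).1 x) = Re x := rfl

variable (H) in
/-- The `𝕆`-algebra of bounded para-linear operators. -/
@[reducible]
noncomputable def algebra : OAlgebra (BRO H H) where
  toOBimodule := bimodule H H
  mul := compL H H H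
  mul_left_paraLinear S p T := Re_eq_zero fun m hm => by
    have h1 : Re ((right p (comp S T)).1 m) = Re (S.1 (T.1 m ▹ p)) := by
      rw [Re_right, Re_comp, map_lsmul_of_mem T hm]
    have h2 : Re ((comp S (right p T)).1 m) = Re (S.1 (T.1 m ▹ p)) := by
      rw [Re_comp, right_apply, map_lsmul_of_mem T hm, map_rsmul_of_mem T hm, sub_self, sub_zero]
    change Re ((right p (comp S T)).1 m - (comp S (right p T)).1 m) = 0
    rw [Re_sub, h1, h2, sub_self]
  mul_right_paraLinear T p S := Re_eq_zero fun m hm => by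
    change Re ((comp (left p S) T).1 m - (left p (comp S T)).1 m) = 0
    rw [Re_sub, Re_comp, Re_left, Re_left, Re_comp, map_rsmul_of_mem T hm, sub_self]
  unit := one H
  unit_mem p q := sub_eq_zero.2 <| ext_Re fun x => by
    change Re ((left (p * q) (one H)).1 x) = Re ((left p (left q (one H))).1 x)
    rw [Re_left, Re_left, Re_left, Re_one, Re_one, Re_rsmul_rsmul]
  unit_mul p T := ext_Re fun x => by
    change Re ((comp (left p (one H)) T).1 x) = Re ((left p T).1 x)
    rw [Re_comp, Re_left, Re_left, Re_one, Re_map_rsmul]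
  mul_unit p S := ext_Re fun x => by
    change Re ((comp S (left p (one H))).1 x) = Re ((right p S).1 x)
    rw [Re_comp, Re_right]
    congr 2
    -- For the identity the term `B` is zero, so `p ⊙ 1` is left multiplication by `p`.
    change p ◃ x + (x ▹ p - x ▹ p) = p ◃ x
    rw [sub_self, add_zero]

end BRO

end Algebra

end OctonionicOp

open OctonionicOp in
theorem mainTheorem5
    {H₁ H₂ H : Type*}
    [NormedAddCommGroup H₁] [NormedSpace ℝ H₁] [PreHilbertOBimodule H₁] [CompleteSpace H₁]
    [NormedAddCommGroup H₂] [NormedSpace ℝ H₂] [PreHilbertOBimodule H₂] [CompleteSpace H₂]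
    [NormedAddCommGroup H] [NormedSpace ℝ H] [PreHilbertOBimodule H] [CompleteSpace H] :
    (∃ S : OBimodule (BRO H₁ H₂), IsOperatorAction S ∧ IsBanachOBimodule S (fun T => ‖T‖)) ∧
    (∃ A : OAlgebra (BRO H H),
      IsOperatorAction A.toOBimodule ∧
      (∀ (S T : BRO H H) (h : H →ₗ[ℝ] H),
        IsRegularComp (S.1 : H →ₗ[ℝ] H) (T.1 : H →ₗ[ℝ] H) h ↔
          h = ((A.mul S T).1 : H →ₗ[ℝ] H)) ∧
      A.unit.1 = ContinuousLinearMap.id ℝ H ∧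
      IsBanachOBimodule A.toOBimodule (fun T => ‖T‖) ∧
      (∀ S T : BRO H H, ‖A.mul S T‖ ≤ 8 * ‖S‖ * ‖T‖) ∧
      IsOctonionicBanachAlgebra A (fun T => 8 * ‖T‖)) := by
  refine ⟨⟨BRO.bimodule H₁ H₂, BRO.isOperatorAction_bimodule, BRO.isBanachOBimodule⟩,
    BRO.algebra H, BRO.isOperatorAction_bimodule, BRO.isRegularComp_iff, rfl,
    BRO.isBanachOBimodule, BRO.norm_comp_le, BRO.isBanachOBimodule.const_mul (by norm_num), ?_⟩
  intro S T
  -- `8 · 8 ‖S‖ ‖T‖ = (8 ‖S‖) (8 ‖T‖)`: the rescaling absorbs the constant.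
  refine (mul_le_mul_of_nonneg_left (BRO.norm_comp_le S T) (by norm_num)).trans_eq ?_
  ring
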